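/- Let $k$ be an algebraically closed field of characteristic $p\geq 3$, let $A(n)=k[X_1,\dots,X_n]/(X_1^p,\dots,X_n^p)$ with canonical generators $x_1,\dots,x_n$, and let $W(n)=\mathrm{Der}_k(A(n))$ be the Jacobson–Witt algebra, a restricted Lie algebra with the commutator bracket and the $p$-map $D\mapsto D^p$; if $n=1$, assume $p\geq 5$. Let $\partial_i\in W(n)$ be the partial derivative with respect to $x_i$. Let $G=\mathrm{Aut}_p(W(n))$ be the group of automorphisms of the restricted Lie algebra $W(n)$, regarded as an algebraic group (a Zariski-closed subgroup of $\mathrm{GL}(W(n))$). For a subspace $\mathfrak t\subseteq W(n)$ put $N_G(\mathfrak t)=\{g\in G : g(\mathfrak t)=\mathfrak t\}$ and $C_G(\mathfrak t)=\{g\in G : g(D)=D \text{ for all } D\in\mathfrak t\}$, and let $N_G(\mathfrak t)^\circ$ be the identity component of $N_G(\mathfrak t)$ in the Zariski topology. A torus of $W(n)$ is an abelian restricted subalgebra all of whose elements are semisimple, an element $D$ being semisimple if it lies in the $k$-span of $D^{p},D^{p^2},\dots$; a maximal torus is a torus not properly contained in another torus. For $0\leq r\leq n$ let $$\mathfrak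 t_r=\sum_{i=1}^{r}k(1+x_i)\partial_i+\sum_{i=r+1}^{n}k\,x_i\partial_i .$$ Then every maximal torus $\mathfrak t$ of $W(n)$ is conjugate under $G$ to $\mathfrak t_r$ for some $0\leq r\leq n$, and $C_G(\mathfrak t)=N_G(\mathfrak t)^{\circ}$. Moreover, for every $r$ with $0\leq r\leq n$ such that $\mathfrak t$ is conjugate under $G$ to $\mathfrak t_r$, $$C_G(\mathfrak t)=N_G(\mathfrak t)^{\circ}\cong (k^*)^{n-r}$$ as algebraic groups. -/

import Mathlib

open scoped Pointwise

noncomputable section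

namespace JacobsonWitt

/-! ### The truncated polynomial ring and the Jacobson-Witt algebra -/

/-- The truncated polynomial ring `A(n) = k[X_1, …, X_n] / (X_1 ^ p, …, X_n ^ p)`. -/
abbrev TruncPoly (k : Type*) [Field k] (p n : ℕ) : Type _ :=
  MvPolynomial (Fin n) k ⧸
    Ideal.span (Set.range fun i : Fin n => (MvPolynomial.X i : MvPolynomial (Fin n) k) ^ p)

/-- The canonical generator `x_i` of `A(n)`. -/
def x (k : Type*) [Field k] (p n : ℕ) (i : Fin n) : TruncPoly k p n :=
  Ideal.Quotient.mk _ (MvPolynomial.X i)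

/-- The Jacobson-Witt algebra `W(n) = Der_k (A(n))`, with the commutator bracket. -/
abbrev W (k : Type*) [Field k] (p n : ℕ) : Type _ :=
  Derivation k (TruncPoly k p n) (TruncPoly k p n)

/-- In characteristic `p`, the `p`-th power of a derivation satisfies the Leibniz rule. -/
theorem pow_char_leibniz {k A : Type*} [Field k] [CommRing A] [Algebra k A]
    (p : ℕ) [Fact p.Prime] [CharP k p] (D : Derivation k A A) (a b : A) :
    ((D : Module.End k A) ^ p) (a * b) =
      a * ((D : Module.End k A) ^ p) b + b * ((D : Module.End k A) ^ p) a := by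
  have hp : p.Prime := Fact.out
  let d : Module.End k A := (D : Module.End k A)
  let S : Module.End k (TensorProduct k A A) := TensorProduct.map d LinearMap.id
  let T : Module.End k (TensorProduct k A A) := TensorProduct.map LinearMap.id d
  let m : TensorProduct k A A →ₗ[k] A := LinearMap.mul' k A
  have hST : Commute S T := by
    refine TensorProduct.ext' fun u v => ?_
    simp [S, T]
  have hm : ∀ z, d (m z) = m ((S + T) z) := by
    intro z
    induction z using TensorProduct.induction_on with
    | zero => simp
    | add u v hu hv => simp only [map_add, hu, hv]
    | tmul u v => simp [m, S, T, d]; ring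
  have hmN : ∀ (N : ℕ) z, (d ^ N) (m z) = m (((S + T) ^ N) z) := by
    intro N
    induction N with
    | zero => simp
    | succ N ih => intro z; rw [pow_succ, pow_succ, Module.End.mul_apply, hm, ih]; rfl
  have hS : ∀ (N : ℕ) u v, (S ^ N) (TensorProduct.tmul k u v) =
      TensorProduct.tmul k ((d ^ N) u) v := by
    intro N
    induction N with
    | zero => simp
    | succ N ih => intro u v; rw [pow_succ, pow_succ, Module.End.mul_apply]; simp [S] at ih ⊢
  have hT : ∀ (N : ℕ) u v, (T ^ N) (TensorProduct.tmul k u v) =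
      TensorProduct.tmul k u ((d ^ N) v) := by
    intro N
    induction N with
    | zero => simp
    | succ N ih => intro u v; rw [pow_succ, pow_succ, Module.End.mul_apply]; simp [T] at ih ⊢
  obtain ⟨R, hR⟩ := hST.exists_add_pow_prime_eq hp
  have h0 : (p : Module.End k (TensorProduct k A A)) = 0 := by
    have := map_natCast (algebraMap k (Module.End k (TensorProduct k A A))) p
    rw [CharP.cast_eq_zero, map_zero] at this
    exact this.symm
  rw [h0] at hR
  have := hmN p (TensorProduct.tmul k a b)
  rw [hR] at this
  simp [hS, hT, m] at this
  change (d ^ p) (a * b) = a * (d ^ p) b + b * (d ^ p) a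
  rw [this]; ring

/-- The `[p]`-map of `W(n)`: the `p`-th power `D ↦ D ^ p` of a derivation, as an endomorphism. -/
def pMap {k : Type*} [Field k] {p n : ℕ} [Fact p.Prime] [CharP k p] (D : W k p n) : W k p n :=
  Derivation.mk' ((D : Module.End k (TruncPoly k p n)) ^ p) fun a b => by
    simpa only [smul_eq_mul] using pow_char_leibniz p D a b

/-- A partial derivative of `k[X_1, …, X_n]` preserves the ideal `(X_1 ^ p, …, X_n ^ p)`. -/
theorem pderiv_mem {k : Type*} [Field k] {p n : ℕ} [CharP k p] (i : Fin n)
    {f : MvPolynomial (Fin n) k}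
    (hf : f ∈ Ideal.span
      (Set.range fun j : Fin n => (MvPolynomial.X j : MvPolynomial (Fin n) k) ^ p)) :
    MvPolynomial.pderiv i f ∈ Ideal.span
      (Set.range fun j : Fin n => (MvPolynomial.X j : MvPolynomial (Fin n) k) ^ p) := by
  induction hf using Submodule.span_induction with
  | mem g hg =>
    obtain ⟨j, rfl⟩ := hg
    have h : MvPolynomial.pderiv i ((MvPolynomial.X j : MvPolynomial (Fin n) k) ^ p) = 0 := by
      rw [Derivation.leibniz_pow, nsmul_eq_mul, CharP.cast_eq_zero, zero_mul]
    simp only [h, Submodule.zero_mem]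
  | zero => simp
  | add g h _ _ hg hh => rw [map_add]; exact Submodule.add_mem _ hg hh
  | smul a g hg' hg =>
    rw [smul_eq_mul, Derivation.leibniz]
    exact Submodule.add_mem _ (Submodule.smul_mem _ _ hg)
      (by rw [smul_eq_mul]; exact Ideal.mul_mem_right _ _ hg')

/-- The partial derivative `∂_i ∈ W(n)`. -/
def partialDeriv (k : Type*) [Field k] (p n : ℕ) [CharP k p] (i : Fin n) : W k p n :=
  Derivation.liftOfSurjective (f := Ideal.Quotient.mkₐ k (Ideal.span
      (Set.range fun j : Fin n => (MvPolynomial.X j : MvPolynomial (Fin n) k) ^ p)))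
    (Ideal.Quotient.mkₐ_surjective k _) (d := MvPolynomial.pderiv i) fun f hf => by
      rw [Ideal.Quotient.mkₐ_eq_mk, Ideal.Quotient.eq_zero_iff_mem] at hf ⊢
      exact pderiv_mem i hf

/-! ### Tori -/

section Tori

variable {k : Type*} [Field k] {p n : ℕ} [Fact p.Prime] [CharP k p]

/-- A torus of `W(n)`: an abelian restricted subalgebra all of whose elements `D` are semisimple,
that is, `D` lies in the span of the iterated `[p]`-powers `D^[p], D^[p]^2, …`.
(A subspace on which the bracket vanishes is a subalgebra.) -/
structure IsTorus (t : Submodule k (W k p n)) : Prop where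
  abelian : ∀ D ∈ t, ∀ E ∈ t, ⁅D, E⁆ = 0
  restricted : ∀ D ∈ t, pMap D ∈ t
  semisimple : ∀ D ∈ t, D ∈ Submodule.span k (Set.range fun i : ℕ => pMap^[i + 1] D)

/-- A torus of `W(n)` that is not properly contained in another torus. -/
def IsMaximalTorus (t : Submodule k (W k p n)) : Prop :=
  Maximal IsTorus t

/-- The element `z_i` of `A(n)`, which is `1 + x_i` for the first `r` indices and `x_i` for the
others. -/
def z (k : Type*) [Field k] (p n r : ℕ) (i : Fin n) : TruncPoly k p n :=
  if (i : ℕ) < r then 1 + x k p n i else x k p n i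

/-- The standard torus `t_r = ∑_{i ≤ r} k (1 + x_i) ∂_i + ∑_{i > r} k x_i ∂_i`. -/
def standardTorus (k : Type*) [Field k] (p n : ℕ) [CharP k p] (r : ℕ) : Submodule k (W k p n) :=
  Submodule.span k (Set.range fun i : Fin n => z k p n r i • partialDeriv k p n i)

end Tori

/-! ### The automorphism group, normalizers and centralizers -/

section Groups

variable (k : Type*) [Field k] (p n : ℕ) [Fact p.Prime] [CharP k p]

/-- The group `G = Aut_p (W(n))` of automorphisms of the restricted Lie algebra `W(n)`,
as a group of linear automorphisms. -/
def G : Subgroup (W k p n ≃ₗ[k] W k p n) where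
  carrier := {g | (∀ D E, g ⁅D, E⁆ = ⁅g D, g E⁆) ∧ ∀ D, g (pMap D) = pMap (g D)}
  one_mem' := ⟨fun _ _ => rfl, fun _ => rfl⟩
  mul_mem' := by
    rintro g h ⟨hg, hg'⟩ ⟨hh, hh'⟩
    exact ⟨fun D E => by simp only [LinearEquiv.mul_apply, hg, hh],
      fun D => by simp only [LinearEquiv.mul_apply, hg', hh']⟩
  inv_mem' := by
    rintro g ⟨hg, hg'⟩
    have e : ∀ D, g (g⁻¹ D) = D := fun D => g.apply_symm_apply D
    exact ⟨fun D E => g.injective (by rw [hg, e, e, e]),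
      fun D => g.injective (by rw [hg', e, e])⟩

variable {k p n}

/-- The normalizer `N_G(t) = {g ∈ G | g(t) = t}`. -/
def normalizer (t : Submodule k (W k p n)) : Subgroup (G k p n) :=
  MulAction.stabilizer (G k p n) t

/-- The centralizer `C_G(t) = {g ∈ G | g(D) = D for all D ∈ t}`. -/
def centralizer (t : Submodule k (W k p n)) : Subgroup (G k p n) :=
  fixingSubgroup (G k p n) (t : Set (W k p n))

end Groups

/-! ### Linear algebraic groups: regular functions, Zariski topology, isomorphisms -/

section AlgebraicGroups

variable {k : Type*} [Field k]

/-- The regular functions on a group `Γ` of automorphisms of a finite-dimensional vector space `V`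
(given by `ρ : Γ →* GL(V)`): the `k`-algebra generated by the matrix coefficients of `g` and of
`g⁻¹`, equivalently, by the matrix coefficients of `g` and by `det(g)⁻¹`. -/
def regularFunctions {V : Type*} [AddCommMonoid V] [Module k V] {Γ : Type*} [Group Γ]
    (ρ : Γ →* (V ≃ₗ[k] V)) : Subalgebra k (Γ → k) :=
  Algebra.adjoin k
    {f | ∃ (ξ : Module.Dual k V) (v : V), f = (fun g => ξ (ρ g v)) ∨ f = fun g => ξ (ρ g⁻¹ v)}

/-- The regular functions on the algebraic torus `(k^*)^m`: the Laurent polynomials in the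
coordinates. -/
def torusRegularFunctions (k : Type*) [Field k] (m : ℕ) : Subalgebra k ((Fin m → kˣ) → k) :=
  Algebra.adjoin k
    {f | ∃ i : Fin m, f = (fun s => (s i : k)) ∨ f = fun s => ((s i)⁻¹ : k)}

/-- The Zariski topology defined by an algebra `R` of functions: the sets `{g | f g ≠ 0}` with
`f ∈ R` form a basis of open sets. -/
@[reducible] def zariskiTopology {Γ : Type*} (R : Subalgebra k (Γ → k)) : TopologicalSpace Γ :=
  TopologicalSpace.generateFrom {U | ∃ f ∈ R, U = {g | f g ≠ 0}}

variable {p n : ℕ} [Fact p.Prime] [CharP k p]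

/-- The regular functions on a subgroup `H` of `G = Aut_p (W(n)) ⊆ GL(W(n))`. -/
def regularFunctionsOf (H : Subgroup (G k p n)) : Subalgebra k (H → k) :=
  regularFunctions ((G k p n).subtype.comp H.subtype)

/-- The identity component `H^∘` of a subgroup `H` of `G`: the connected component of `1` in `H`
in the Zariski topology. -/
def identityComponent (H : Subgroup (G k p n)) : Set (G k p n) :=
  @connectedComponentIn _ (zariskiTopology (regularFunctions (G k p n).subtype))
    (H : Set (G k p n)) 1

/-- `H` is isomorphic to `(k^*)^m` as an algebraic group: there is a group isomorphism which,
together with its inverse, pulls regular functions back to regular functions. -/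
def IsIsomorphicToTorus (H : Subgroup (G k p n)) (m : ℕ) : Prop :=
  ∃ e : H ≃* (Fin m → kˣ),
    ∀ f : (Fin m → kˣ) → k, f ∘ e ∈ regularFunctionsOf H ↔ f ∈ torusRegularFunctions k m

end AlgebraicGroups

end JacobsonWitt

end

/-! Conjugacy. An element of a torus is a combination of its own iterated p-th powers, so as an
operator on A(n) it is killed by an additive polynomial with derivative 1 and is diagonalisable. The
torus is abelian, so its common eigenvectors span A(n), and n of them have independent linear parts.
Scaled to have constant term 0 or 1 and reordered, these are the images of the z_i under an
automorphism of A(n). The corresponding conjugate of t_r contains the given torus, and maximality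
forces equality (`IsMaximalTorus.exists_conj`).

Centralizer. An automorphism g that fixes t_r pointwise preserves weight spaces, and z^a ∂_i has
weight a - ε_i with a in (Z/p)^n. Rescaling the nilpotent variables (indices at least r) gives a
copy of (k^*)^(n-r) in the centralizer, and the point is that nothing else is there (`range_diag`).
If r = n, all z_i are units and the weight space of a is z^a t_n. So g becomes a family of linear
maps of k^n subject to the bracket and the p-map, and these relations force every map to be the
identity (`rigidity_of_two_le`, and `character_eq_one` for n = 1, where p = 3 has to be excluded).
If r < n, brackets with z_j^2 ∂_j and the relation ∂_j^p = 0 show that g only rescales each ∂_j with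
j nilpotent (`centralizer_partialDeriv`). After correction by a diagonal element g fixes these ∂_j,
and an induction on the degree in the nilpotent variables gives g = 1
(`eq_one_of_fixes_partialDeriv`).

Identity component. The centralizer is a torus, hence connected, so it lies in the identity
component of the normalizer. Conversely the normalizer permutes the finitely many D in t with D^p =
D. A connected set containing 1 cannot move any of them, and they span t
(`identityComponent_normalizer`). Finally the coordinates of (k^*)^(n-r) and their inverses are
matrix coefficients, so the group isomorphism is one of algebraic groups. -/

open scoped Pointwise

noncomputable section

namespace JacobsonWitt

/-! ### Generators, derivations and Frobenius on A(n). -/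

section Basics

variable {k : Type*} [Field k] {p n : ℕ}

/-- A property of elements of `A(n)` which holds for constants and is stable under sums and under
multiplication by the generators holds everywhere. -/
theorem truncPoly_induction {P : TruncPoly k p n → Prop} (hC : ∀ c : k, P (algebraMap k _ c))
    (hadd : ∀ a b, P a → P b → P (a + b)) (hX : ∀ a i, P a → P (a * x k p n i)) (a) : P a := by
  obtain ⟨f, rfl⟩ := Ideal.Quotient.mk_surjective a
  induction f using MvPolynomial.induction_on with
  | C c => exact hC c
  | add f g hf hg => rw [map_add]; exact hadd _ _ hf hg
  | mul_X f i hf => rw [map_mul]; exact hX _ i hf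

theorem x_pow_p (i : Fin n) : x k p n i ^ p = 0 := by
  rw [x, ← map_pow, Ideal.Quotient.eq_zero_iff_mem]
  exact Ideal.subset_span ⟨i, rfl⟩

/-- The algebra endomorphism of `A(n)` with given values on the generators. -/
def liftHom {B : Type*} [CommRing B] [Algebra k B] (a : Fin n → B) (ha : ∀ i, a i ^ p = 0) :
    TruncPoly k p n →ₐ[k] B :=
  Ideal.Quotient.liftₐ _ (MvPolynomial.aeval a) fun f hf => by
    have : Ideal.span (Set.range fun i : Fin n => (MvPolynomial.X i : MvPolynomial (Fin n) k) ^ p)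
        ≤ RingHom.ker (MvPolynomial.aeval a : MvPolynomial (Fin n) k →ₐ[k] B) := by
      rw [Ideal.span_le]
      rintro _ ⟨i, rfl⟩
      simp [RingHom.mem_ker, ha]
    exact this hf

@[simp] theorem liftHom_x {B : Type*} [CommRing B] [Algebra k B] (a : Fin n → B)
    (ha : ∀ i, a i ^ p = 0) (i : Fin n) : liftHom a ha (x k p n i) = a i :=
  MvPolynomial.aeval_X a i

theorem algHom_ext_x {B : Type*} [CommRing B] [Algebra k B] {f g : TruncPoly k p n →ₐ[k] B}
    (h : ∀ i, f (x k p n i) = g (x k p n i)) : f = g := by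
  ext a
  induction a using truncPoly_induction with
  | hC c => simp
  | hadd a b ha hb => simp [ha, hb]
  | hX a i ha => simp [ha, h]

theorem derivation_ext_x {D E : W k p n} (h : ∀ i, D (x k p n i) = E (x k p n i)) : D = E := by
  ext a
  induction a using truncPoly_induction with
  | hC c => simp
  | hadd a b ha hb => simp [ha, hb]
  | hX a i ha => simp [ha, h]

theorem derivation_z (D : W k p n) (r : ℕ) (i : Fin n) : D (z k p n r i) = D (x k p n i) := by
  unfold z; split_ifs <;> simp

theorem z_of_le {r : ℕ} {i : Fin n} (h : r ≤ (i : ℕ)) : z k p n r i = x k p n i := by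
  unfold z; rw [if_neg (by omega)]

theorem derivation_ext_z (r : ℕ) {D E : W k p n} (h : ∀ i, D (z k p n r i) = E (z k p n r i)) :
    D = E :=
  derivation_ext_x fun i => by simpa only [derivation_z] using h i

theorem bracket_apply (D E : W k p n) (a : TruncPoly k p n) : ⁅D, E⁆ a = D (E a) - E (D a) := by
  rw [Derivation.commutator_apply]

section PartialDeriv

variable [CharP k p]

theorem partialDeriv_x (i j : Fin n) :
    partialDeriv k p n i (x k p n j) = if j = i then 1 else 0 := by
  have := Derivation.liftOfSurjective_apply (f := Ideal.Quotient.mkₐ k (Ideal.span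
      (Set.range fun j : Fin n => (MvPolynomial.X j : MvPolynomial (Fin n) k) ^ p)))
    (Ideal.Quotient.mkₐ_surjective k _) (d := MvPolynomial.pderiv i) (fun f hf => by
      rw [Ideal.Quotient.mkₐ_eq_mk, Ideal.Quotient.eq_zero_iff_mem] at hf ⊢
      exact pderiv_mem i hf) (MvPolynomial.X j)
  refine Eq.trans this ?_
  rw [MvPolynomial.pderiv_X]
  by_cases h : j = i
  · subst h; simp
  · simp [h]

theorem partialDeriv_z (r : ℕ) (i j : Fin n) :
    partialDeriv k p n i (z k p n r j) = if j = i then 1 else 0 := by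
  rw [derivation_z, partialDeriv_x]

theorem sum_smul_partialDeriv_z (r : ℕ) (f : Fin n → TruncPoly k p n) (j : Fin n) :
    (∑ i, f i • partialDeriv k p n i : W k p n) (z k p n r j) = f j := by
  have : ∀ s : Finset (Fin n), (∑ i ∈ s, f i • partialDeriv k p n i : W k p n) (z k p n r j)
      = ∑ i ∈ s, f i * (if j = i then 1 else 0) := by
    intro s
    induction s using Finset.induction_on with
    | empty => simp
    | insert a s ha ih => rw [Finset.sum_insert ha, Finset.sum_insert ha, Derivation.add_apply, ih,
        Derivation.smul_apply, partialDeriv_z, smul_eq_mul]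
  rw [this]; simp

theorem eq_sum_smul_partialDeriv (r : ℕ) (D : W k p n) :
    D = ∑ i, D (z k p n r i) • partialDeriv k p n i :=
  derivation_ext_z r fun j => by rw [sum_smul_partialDeriv_z]

end PartialDeriv

variable [hpp : Fact p.Prime]

/-- The augmentation `A(n) → k`, evaluation at the origin. -/
def eval0 (k : Type*) [Field k] (p n : ℕ) [hpp : Fact p.Prime] : TruncPoly k p n →ₐ[k] k :=
  liftHom (fun _ => 0) fun _ => by simp [hpp.out.ne_zero]

@[simp] theorem eval0_x (i : Fin n) : eval0 k p n (x k p n i) = 0 := liftHom_x _ _ _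

instance : Nontrivial (TruncPoly k p n) := (eval0 k p n).toRingHom.domain_nontrivial

theorem eval0_z (r : ℕ) (i : Fin n) : eval0 k p n (z k p n r i) = if (i : ℕ) < r then 1 else 0 := by
  unfold z; split_ifs <;> simp

variable [CharP k p]

instance : CharP (TruncPoly k p n) p :=
  charP_of_injective_algebraMap (algebraMap k (TruncPoly k p n)).injective p

/-- Frobenius is additive and kills every generator, so only the constant term survives.
Consequently any n elements with zero constant term are admissible images of the generators. -/
theorem pow_p (a : TruncPoly k p n) : a ^ p = algebraMap k _ (eval0 k p n a ^ p) := by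
  induction a using truncPoly_induction with
  | hC c => simp
  | hadd a b ha hb => rw [add_pow_char, ha, hb, ← map_add, ← add_pow_char, map_add]
  | hX a i ha => rw [mul_pow, x_pow_p, map_mul, eval0_x]; simp [hpp.out.ne_zero]

theorem z_pow_p_of_lt {r : ℕ} {i : Fin n} (h : (i : ℕ) < r) : z k p n r i ^ p = 1 := by
  rw [pow_p, eval0_z, if_pos h]; simp

theorem z_pow_p_of_le {r : ℕ} {i : Fin n} (h : r ≤ (i : ℕ)) : z k p n r i ^ p = 0 := by
  rw [z_of_le h, x_pow_p]

end Basics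

/-! ### Monomials in the z_i as weight vectors of the standard torus. -/

section Monomials

variable (k : Type*) [Field k] {p n : ℕ} [hpp : Fact p.Prime]

/-- The monomial `∏ z_i ^ (a_i)` with exponents read in `{0, …, p - 1}`. -/
def mono (r : ℕ) (a : Fin n → ZMod p) : TruncPoly k p n := ∏ i, z k p n r i ^ (a i).val

@[simp] theorem mono_zero (r : ℕ) : mono k r (0 : Fin n → ZMod p) = 1 := by simp [mono]

theorem val_single_one (i j : Fin n) :
    ((Pi.single i 1 : Fin n → ZMod p) j).val = if j = i then 1 else 0 := by
  have := Fact.mk hpp.out.one_lt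
  by_cases h : j = i
  · subst h; simp [ZMod.val_one]
  · simp [h]

theorem val_sub_one {a : ZMod p} (ha : a ≠ 0) : (a - 1).val = a.val - 1 := by
  have := Fact.mk hpp.out.one_lt
  rw [ZMod.val_sub, ZMod.val_one]
  rw [ZMod.val_one]
  exact Nat.one_le_iff_ne_zero.2 (by rwa [Ne, ZMod.val_eq_zero])

theorem mono_single (r : ℕ) (i : Fin n) :
    mono k r (Pi.single i 1 : Fin n → ZMod p) = z k p n r i := by
  simp only [mono, val_single_one]
  simp

theorem z_mul_mono_of_eq {r : ℕ} {i : Fin n} (hi : r ≤ i) {a : Fin n → ZMod p} (h : a i = -1) :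
    z k p n r i * mono k r a = 0 := by
  have hv : (a i).val = p - 1 := by
    have h1 : (-1 : ZMod p) = ((p - 1 : ℕ) : ZMod p) := by
      rw [Nat.cast_sub hpp.out.one_le]; simp
    rw [h, h1, ZMod.val_cast_of_lt (Nat.sub_lt hpp.out.pos one_pos)]
  rw [mono, ← Finset.mul_prod_erase _ _ (Finset.mem_univ i), ← mul_assoc, ← pow_succ', hv,
    Nat.sub_add_cancel hpp.out.one_le, z_of_le hi, x_pow_p, zero_mul]

variable [CharP k p]

/-- Exponents add modulo p. For i < r this is harmless because z_i^p = 1; for the nilpotent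
variables an overflow would give 0 instead of a wrapped monomial, hence the bound. -/
theorem mono_mul_mono {r : ℕ} {a b : Fin n → ZMod p}
    (h : ∀ i : Fin n, r ≤ i → (a i).val + (b i).val < p) :
    mono k r a * mono k r b = mono k r (a + b) := by
  rw [mono, mono, mono, ← Finset.prod_mul_distrib]
  refine Finset.prod_congr rfl fun i _ => ?_
  rw [← pow_add, Pi.add_apply]
  rcases lt_or_ge (i : ℕ) r with hi | hi
  · rw [ZMod.val_add, pow_eq_pow_mod _ (z_pow_p_of_lt hi)]
  · rw [ZMod.val_add_of_lt (h i hi)]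

theorem z_mul_mono {r : ℕ} {i : Fin n} {a : Fin n → ZMod p} (h : (i : ℕ) < r ∨ a i ≠ -1) :
    z k p n r i * mono k r a = mono k r (a + Pi.single i 1) := by
  rw [← mono_single, mul_comm, mono_mul_mono]
  intro j hj
  rw [val_single_one]
  split_ifs with hij
  · subst hij
    have h' := h.resolve_left (by omega)
    have h1 := ZMod.val_lt (a j)
    have h2 : (a j).val + 1 ≠ p := fun e => h' (by
      rw [eq_neg_iff_add_eq_zero, ← ZMod.natCast_zmod_val (a j), ← Nat.cast_one, ← Nat.cast_add, e,
        ZMod.natCast_self])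
    omega
  · exact ZMod.val_lt _

theorem span_mono (r : ℕ) :
    Submodule.span k (Set.range (mono k r : (Fin n → ZMod p) → TruncPoly k p n)) = ⊤ := by
  set S := Submodule.span k (Set.range (mono k r : (Fin n → ZMod p) → TruncPoly k p n))
  have hz : ∀ i, ∀ a ∈ S, z k p n r i * a ∈ S := by
    intro i a ha
    induction ha using Submodule.span_induction with
    | mem a ha =>
      obtain ⟨α, rfl⟩ := ha
      by_cases h : (i : ℕ) < r ∨ α i ≠ -1
      · rw [z_mul_mono k h]; exact Submodule.subset_span ⟨_, rfl⟩
      · push Not at h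
        rw [z_mul_mono_of_eq k h.1 h.2]; exact zero_mem _
    | zero => simp
    | add a b _ _ ha hb => rw [mul_add]; exact add_mem ha hb
    | smul c a _ ha => rw [mul_smul_comm]; exact Submodule.smul_mem _ _ ha
  rw [eq_top_iff]
  rintro a -
  induction a using truncPoly_induction with
  | hC c =>
    rw [Algebra.algebraMap_eq_smul_one, ← mono_zero k r]
    exact Submodule.smul_mem _ _ (Submodule.subset_span ⟨_, rfl⟩)
  | hadd a b ha hb => exact add_mem ha hb
  | hX a i ha =>
    -- Multiplication by x_i is multiplication by z_i, minus the identity when i < r.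
    have : a * x k p n i = z k p n r i * a - (if (i : ℕ) < r then 1 else 0 : k) • a := by
      unfold z; split_ifs <;> simp <;> ring
    rw [this]
    exact sub_mem (hz i a ha) (Submodule.smul_mem _ _ ha)

/-- The embedding of the prime field into `k`. -/
def fp (p : ℕ) [Fact p.Prime] [CharP k p] : ZMod p →+* k := ZMod.castHom dvd_rfl k

theorem natCast_val (a : ZMod p) : ((a.val : ℕ) : k) = fp k p a := by
  rw [fp, ZMod.castHom_apply, ZMod.natCast_val]

variable {k}

/-- When a_i = 0 the exponent on the right wraps around to p - 1, but its coefficient vanishes, so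
one formula covers all cases. -/
theorem partialDeriv_mono (r : ℕ) (i : Fin n) (a : Fin n → ZMod p) :
    partialDeriv k p n i (mono k r a) = fp k p (a i) • mono k r (a - Pi.single i 1) := by
  have hR : partialDeriv k p n i (∏ j ∈ Finset.univ.erase i, z k p n r j ^ (a j).val) = 0 := by
    refine Finset.prod_induction _ (fun b => partialDeriv k p n i b = 0) ?_ (by simp) ?_
    · intro b c hb hc; simp [hb, hc]
    · intro j hj
      rw [Derivation.leibniz_pow, partialDeriv_z, if_neg (Finset.ne_of_mem_erase hj)]; simp
  have hR' : ∏ j ∈ Finset.univ.erase i, z k p n r j ^ ((a - Pi.single i 1 : Fin n → ZMod p) j).val =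
      ∏ j ∈ Finset.univ.erase i, z k p n r j ^ (a j).val :=
    Finset.prod_congr rfl fun j hj => by simp [Finset.ne_of_mem_erase hj]
  have hm : ∀ b : Fin n → ZMod p, mono k r b =
      z k p n r i ^ (b i).val * ∏ j ∈ Finset.univ.erase i, z k p n r j ^ (b j).val := fun b => by
    rw [mono, Finset.mul_prod_erase _ (fun j => z k p n r j ^ (b j).val) (Finset.mem_univ i)]
  rw [hm, hm (a - _), hR', Derivation.leibniz, hR, smul_zero, zero_add, Derivation.leibniz_pow,
    partialDeriv_z, if_pos rfl, ← natCast_val]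
  by_cases h : a i = 0
  · simp [h]
  · have h1 : ((a - Pi.single i 1 : Fin n → ZMod p) i).val = (a i).val - 1 := by
      rw [Pi.sub_apply, Pi.single_eq_same, val_sub_one]; assumption
    rw [h1, smul_eq_mul, smul_eq_mul, mul_one, nsmul_eq_mul, Nat.cast_smul_eq_nsmul, nsmul_eq_mul]
    ring

/-- Differentiating lowers the total exponent with a nonzero factor, until the monomial 1 is
reached. -/
theorem mono_ne_zero (r : ℕ) (a : Fin n → ZMod p) : mono k r a ≠ 0 := by
  generalize hN : ∑ i, (a i).val = N
  induction N generalizing a with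
  | zero =>
    have : a = 0 := by
      ext i
      simpa using (Finset.sum_eq_zero_iff.1 hN) i (Finset.mem_univ i)
    rw [this, mono_zero]; exact one_ne_zero
  | succ N ih =>
    obtain ⟨i, hi⟩ : ∃ i, a i ≠ 0 := by
      by_contra! h
      simp [h] at hN
    intro h0
    have h1 := partialDeriv_mono (k := k) r i a
    rw [h0, map_zero, eq_comm, smul_eq_zero_iff_right (by simpa using hi)] at h1
    refine ih _ ?_ h1
    have h2 : ((a - Pi.single i 1 : Fin n → ZMod p) i).val = (a i).val - 1 := by
      rw [Pi.sub_apply, Pi.single_eq_same, val_sub_one]; assumption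
    have h3 : (a i).val ≠ 0 := by rwa [Ne, ZMod.val_eq_zero]
    rw [← Finset.add_sum_erase _ _ (Finset.mem_univ i)] at hN ⊢
    rw [h2, Finset.sum_congr rfl (g := fun j => (a j).val) fun j hj => by
      simp [Finset.ne_of_mem_erase hj]]
    omega

/-- The element `z_i ∂_i` of the standard torus. -/
def euler (k : Type*) [Field k] (p n : ℕ) [CharP k p] (r : ℕ) (i : Fin n) : W k p n :=
  z k p n r i • partialDeriv k p n i

theorem euler_mono (r : ℕ) (i : Fin n) (a : Fin n → ZMod p) :
    euler k p n r i (mono k r a) = fp k p (a i) • mono k r a := by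
  rw [euler, Derivation.smul_apply, partialDeriv_mono, smul_eq_mul, mul_smul_comm]
  by_cases h : a i = 0
  · simp [h]
  · rw [z_mul_mono, sub_add_cancel]
    right; simpa using h

theorem euler_z (r : ℕ) (i j : Fin n) :
    euler k p n r i (z k p n r j) = if j = i then z k p n r j else 0 := by
  rw [euler, Derivation.smul_apply, partialDeriv_z]
  split_ifs with h
  · subst h; simp
  · simp

/-- The simultaneous eigenspaces of the standard torus on `A(n)` are spanned by the monomials. -/
theorem exists_smul_mono (r : ℕ) (b : Fin n → ZMod p) {f : TruncPoly k p n}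
    (hf : ∀ i, euler k p n r i f = fp k p (b i) • f) : ∃ c : k, f = c • mono k r b := by
  -- By Fermat, 1 - (c - b_i)^(p-1) is 1 if c = b_i and 0 for any other c in the prime field. The
  -- product of the P i therefore fixes f, while it sends every monomial other than the one with
  -- exponent b to 0.
  let P : Fin n → Module.End k (TruncPoly k p n) := fun i =>
    1 - ((euler k p n r i : Module.End k (TruncPoly k p n)) - fp k p (b i) • 1) ^ (p - 1)
  have hp1 : p - 1 ≠ 0 := by have := hpp.out.two_le; omega
  have key : ∀ (i : Fin n) (c : k) (g : TruncPoly k p n), euler k p n r i g = c • g →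
      P i g = (1 - (c - fp k p (b i)) ^ (p - 1)) • g := by
    intro i c g hg
    have : ∀ m : ℕ, (((euler k p n r i : Module.End k (TruncPoly k p n)) - fp k p (b i) • 1) ^ m) g
        = (c - fp k p (b i)) ^ m • g := by
      intro m
      induction m with
      | zero => simp
      | succ m ih =>
        rw [pow_succ', Module.End.mul_apply, ih, map_smul]
        simp only [LinearMap.sub_apply, Derivation.coeFn_coe, hg, LinearMap.smul_apply,
          Module.End.one_apply, ← sub_smul, smul_smul, pow_succ]
    simp only [P, LinearMap.sub_apply, this, Module.End.one_apply, sub_smul, one_smul]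
  have hfix : ∀ l : List (Fin n), (l.map P).prod f = f := by
    intro l
    induction l with
    | nil => simp
    | cons i l ih =>
      rw [List.map_cons, List.prod_cons, Module.End.mul_apply, ih, key i _ f (hf i)]
      simp [hp1]
  have hmono : ∀ (l : List (Fin n)) (a : Fin n → ZMod p), (∀ i ∈ l, a i = b i) ∨
      (l.map P).prod (mono k r a) = 0 := by
    intro l a
    have : ∀ l : List (Fin n), ∃ c : k, (l.map P).prod (mono k r a) = c • mono k r a ∧
        (c ≠ 0 → ∀ i ∈ l, a i = b i) := by
      intro l
      induction l with
      | nil => exact ⟨1, by simp, by simp⟩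
      | cons i l ih =>
        obtain ⟨c, hc, hc'⟩ := ih
        refine ⟨c * (1 - (fp k p (a i) - fp k p (b i)) ^ (p - 1)), ?_, ?_⟩
        · rw [List.map_cons, List.prod_cons, Module.End.mul_apply, hc, map_smul,
            key i _ _ (euler_mono r i a), smul_smul]
        · intro hne j hj
          rcases List.mem_cons.1 hj with rfl | hj
          · by_contra hab
            apply hne
            rw [← map_sub, ← map_pow, ZMod.pow_card_sub_one_eq_one (sub_ne_zero.2 hab)]
            simp
          · exact hc' (left_ne_zero_of_mul hne) j hj
    obtain ⟨c, hc, hc'⟩ := this l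
    by_cases h0 : c = 0
    · right; rw [hc, h0, zero_smul]
    · exact Or.inl (hc' h0)
  have hall : ∀ g : TruncPoly k p n, (Finset.univ.toList.map P).prod g ∈
      Submodule.span k {mono k r b} := by
    intro g
    have hg : g ∈ Submodule.span k (Set.range (mono k r)) := by rw [span_mono]; trivial
    induction hg using Submodule.span_induction with
    | mem g hg =>
      obtain ⟨a, rfl⟩ := hg
      rcases hmono Finset.univ.toList a with h | h
      · obtain rfl : a = b := by ext i; rw [h i (by simp)]
        have : ∀ l : List (Fin n), (l.map P).prod (mono k r a) = mono k r a := by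
          intro l
          induction l with
          | nil => simp
          | cons i l ih =>
            rw [List.map_cons, List.prod_cons, Module.End.mul_apply, ih,
              key i _ _ (euler_mono r i a)]
            simp [hp1]
        rw [this]
        exact Submodule.mem_span_singleton_self _
      · rw [h]; exact zero_mem _
    | zero => simp
    | add a c _ _ ha hc => rw [map_add]; exact add_mem ha hc
    | smul c a _ ha => rw [map_smul]; exact Submodule.smul_mem _ _ ha
  have := hall f
  rw [hfix, Submodule.mem_span_singleton] at this
  obtain ⟨c, hc⟩ := this
  exact ⟨c, hc.symm⟩

/-- A derivation of weight `w` with respect to the standard torus maps `z_i` to a multiple of the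
monomial of weight `w + ε_i`. -/
theorem exists_weight_form (r : ℕ) (w : Fin n → ZMod p) {E : W k p n}
    (hE : ∀ j, ⁅euler k p n r j, E⁆ = fp k p (w j) • E) :
    ∃ c : Fin n → k, ∀ i, E (z k p n r i) = c i • mono k r (w + Pi.single i 1) := by
  have : ∀ i, ∃ c : k, E (z k p n r i) = c • mono k r (w + Pi.single i 1) := by
    intro i
    refine exists_smul_mono r _ fun j => ?_
    have h := congrArg (fun D : W k p n => D (z k p n r i)) (hE j)
    simp only [bracket_apply, Derivation.smul_apply, euler_z] at h
    rw [sub_eq_iff_eq_add] at h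
    rw [h, Pi.add_apply, map_add, add_smul]
    by_cases hij : i = j
    · subst hij; simp
    · simp [hij, Ne.symm hij]
  choose c hc using this
  exact ⟨c, hc⟩

theorem euler_bracket_mono (r : ℕ) (i j : Fin n) (a : Fin n → ZMod p) :
    ⁅euler k p n r j, mono k r a • partialDeriv k p n i⁆ =
      fp k p ((a - Pi.single i 1 : Fin n → ZMod p) j) • (mono k r a • partialDeriv k p n i) := by
  refine derivation_ext_z r fun l => ?_
  simp only [bracket_apply, Derivation.smul_apply, euler_z, partialDeriv_z, Derivation.leibniz,
    euler_mono, smul_eq_mul]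
  by_cases h1 : l = j <;> by_cases h2 : l = i <;> simp_all [sub_smul, partialDeriv_z]

end Monomials

/-! ### The p-map on eigenvectors. -/

section PMap

variable {k : Type*} [Field k] {p n : ℕ} [hpp : Fact p.Prime] [CharP k p]

theorem pMap_apply (D : W k p n) (a : TruncPoly k p n) :
    pMap D a = ((D : Module.End k (TruncPoly k p n)) ^ p) a := rfl

theorem pow_apply_of_eigen {M : Type*} [AddCommGroup M] [Module k M] {D : Module.End k M} {a : M}
    {c : k} (h : D a = c • a) (m : ℕ) : (D ^ m) a = c ^ m • a := by
  induction m with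
  | zero => simp
  | succ m ih => rw [pow_succ', Module.End.mul_apply, ih, map_smul, h, smul_smul, pow_succ]

theorem pMap_apply_of_eigen {D : W k p n} {a : TruncPoly k p n} {c : k} (h : D a = c • a) :
    pMap D a = c ^ p • a := by
  rw [pMap_apply]; exact pow_apply_of_eigen h p

end PMap

/-! ### Automorphisms of A(n) acting on W(n), and the action of G on tori. -/

section Conj

variable {k : Type*} [Field k] {p n : ℕ}

/-- Conjugation of derivations by an automorphism of `A(n)`. -/
def conj (φ : TruncPoly k p n ≃ₐ[k] TruncPoly k p n) : W k p n ≃ₗ[k] W k p n where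
  toFun D := Derivation.mk' (φ.toLinearMap ∘ₗ (D : TruncPoly k p n →ₗ[k] TruncPoly k p n) ∘ₗ
    φ.symm.toLinearMap) fun a b => by simp
  invFun D := Derivation.mk' (φ.symm.toLinearMap ∘ₗ
    (D : TruncPoly k p n →ₗ[k] TruncPoly k p n) ∘ₗ φ.toLinearMap) fun a b => by simp
  map_add' D E := by ext a; exact map_add φ _ _
  map_smul' c D := by ext a; exact map_smul φ _ _
  left_inv D := by
    ext a
    change φ.symm (φ (D (φ.symm (φ a)))) = D a
    simp
  right_inv D := by
    ext a
    change φ (φ.symm (D (φ (φ.symm a)))) = D a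
    simp

@[simp] theorem conj_apply (φ : TruncPoly k p n ≃ₐ[k] TruncPoly k p n) (D : W k p n)
    (a : TruncPoly k p n) : conj φ D a = φ (D (φ.symm a)) := rfl

variable [hpp : Fact p.Prime] [CharP k p]

/-- The automorphism of the restricted Lie algebra `W(n)` induced by an automorphism of `A(n)`. -/
def conjG : (TruncPoly k p n ≃ₐ[k] TruncPoly k p n) →* G k p n where
  toFun φ := ⟨conj φ, fun D E => by ext a; simp [bracket_apply], fun D => by
    have : ∀ (m : ℕ) (a : TruncPoly k p n),
        φ (((D : Module.End k (TruncPoly k p n)) ^ m) (φ.symm a)) =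
        (((conj φ D : W k p n) : Module.End k (TruncPoly k p n)) ^ m) a := by
      intro m
      induction m with
      | zero => simp
      | succ m ih =>
        intro a
        rw [pow_succ', pow_succ', Module.End.mul_apply, Module.End.mul_apply, ← ih]
        simp
    ext a
    exact this p a⟩
  map_one' := by ext; rfl
  map_mul' φ ψ := by ext; rfl

theorem G_bracket (g : G k p n) (D E : W k p n) : g.1 ⁅D, E⁆ = ⁅g.1 D, g.1 E⁆ := g.2.1 D E

theorem G_pMap (g : G k p n) (D : W k p n) : g.1 (pMap D) = pMap (g.1 D) := g.2.2 D

theorem G_mul_apply (g h : G k p n) (D : W k p n) : (g * h).1 D = g.1 (h.1 D) := rfl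

theorem G_inv_apply_self (g : G k p n) (D : W k p n) : g⁻¹.1 (g.1 D) = D :=
  g.1.symm_apply_apply D

theorem G_apply_inv_self (g : G k p n) (D : W k p n) : g.1 (g⁻¹.1 D) = D :=
  g.1.apply_symm_apply D

theorem mem_smul_iff (g : G k p n) (t : Submodule k (W k p n)) (D : W k p n) :
    D ∈ g • t ↔ ∃ E ∈ t, g.1 E = D := Iff.rfl

theorem mem_smul_iff_inv (g : G k p n) (t : Submodule k (W k p n)) (D : W k p n) :
    D ∈ g • t ↔ g⁻¹.1 D ∈ t := by
  rw [mem_smul_iff]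
  constructor
  · rintro ⟨E, hE, rfl⟩; rwa [G_inv_apply_self]
  · exact fun h => ⟨_, h, G_apply_inv_self g D⟩

theorem mem_centralizer (g : G k p n) (t : Submodule k (W k p n)) :
    g ∈ centralizer t ↔ ∀ D ∈ t, g.1 D = D := by
  rw [centralizer, mem_fixingSubgroup_iff]; rfl

theorem mem_normalizer (g : G k p n) (t : Submodule k (W k p n)) :
    g ∈ normalizer t ↔ g • t = t := by
  rw [normalizer, MulAction.mem_stabilizer_iff]

theorem centralizer_le_normalizer (t : Submodule k (W k p n)) : centralizer t ≤ normalizer t := by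
  intro g hg
  rw [mem_normalizer]
  rw [mem_centralizer] at hg
  ext D
  rw [mem_smul_iff]
  constructor
  · rintro ⟨E, hE, rfl⟩; rwa [hg E hE]
  · exact fun h => ⟨D, h, hg D h⟩

theorem IsTorus.smul {t : Submodule k (W k p n)} (ht : IsTorus t) (g : G k p n) :
    IsTorus (g • t) := by
  constructor
  · intro D hD E hE
    obtain ⟨D, hDt, rfl⟩ := (mem_smul_iff _ _ _).1 hD
    obtain ⟨E, hEt, rfl⟩ := (mem_smul_iff _ _ _).1 hE
    rw [← G_bracket, ht.abelian D hDt E hEt, map_zero]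
  · intro D hD
    obtain ⟨D, hDt, rfl⟩ := (mem_smul_iff _ _ _).1 hD
    rw [← G_pMap]
    exact (mem_smul_iff _ _ _).2 ⟨_, ht.restricted D hDt, rfl⟩
  · intro D hD
    obtain ⟨D, hDt, rfl⟩ := (mem_smul_iff _ _ _).1 hD
    have h := Submodule.mem_map_of_mem (f := (g.1 : W k p n →ₗ[k] W k p n)) (ht.semisimple D hDt)
    rw [Submodule.map_span, ← Set.range_comp] at h
    have hc : ∀ i : ℕ, g.1 (pMap^[i] D) = pMap^[i] (g.1 D) := fun i =>
      (Function.Semiconj.iterate_right (f := g.1) (fun D => G_pMap g D) i) D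
    have he : (⇑(g.1 : W k p n →ₗ[k] W k p n) ∘ fun i : ℕ => pMap^[i + 1] D) =
        fun i : ℕ => pMap^[i + 1] (g.1 D) := funext fun i => hc (i + 1)
    rw [he] at h
    exact h

end Conj

/-! ### The standard tori in coordinates. -/

section StandardTorus

variable {k : Type*} [Field k] {p n : ℕ} [hpp : Fact p.Prime] [CharP k p]

theorem mem_standardTorus {r : ℕ} {D : W k p n} :
    D ∈ standardTorus k p n r ↔ ∃ c : Fin n → k, ∀ i, D (z k p n r i) = c i • z k p n r i := by
  rw [standardTorus, Submodule.mem_span_range_iff_exists_fun]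
  refine exists_congr fun c => ?_
  have : ∀ i, (∑ i, c i • z k p n r i • partialDeriv k p n i : W k p n) (z k p n r i) =
      c i • z k p n r i := by
    intro i
    have := sum_smul_partialDeriv_z (k := k) (p := p) r (fun i => c i • z k p n r i) i
    simp only [smul_assoc] at this
    exact this
  constructor
  · rintro rfl i; exact this i
  · intro h; exact derivation_ext_z r fun i => by rw [this, h]

theorem euler_mem_standardTorus (r : ℕ) (i : Fin n) :
    euler k p n r i ∈ standardTorus k p n r := Submodule.subset_span ⟨i, rfl⟩

theorem z_ne_zero (r : ℕ) (i : Fin n) : z k p n r i ≠ 0 := by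
  rw [← mono_single]; exact mono_ne_zero _ _

/-- Over a perfect field of characteristic `p`, a vector is a combination of its Frobenius
twists. -/
theorem mem_span_frobenius [IsAlgClosed k] (v : Fin n → k) :
    v ∈ Submodule.span k (Set.range fun i : ℕ => v ^ p ^ (i + 1)) := by
  have hdep : ¬ LinearIndependent k (fun i : ℕ => v ^ p ^ i) := fun h => by
    have := h.finite
    exact not_finite ℕ
  rw [linearIndependent_iff'] at hdep
  push Not at hdep
  obtain ⟨s, g, hsum, i₀, hi₀, hg₀⟩ := hdep
  classical
  have hne : (s.filter fun i => g i ≠ 0).Nonempty := ⟨i₀, by simp [hi₀, hg₀]⟩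
  set m := (s.filter fun i => g i ≠ 0).min' hne with hm
  have hms : m ∈ s.filter fun i => g i ≠ 0 := Finset.min'_mem _ _
  have hmin : ∀ i ∈ s.filter fun i => g i ≠ 0, m ≤ i := fun i hi => Finset.min'_le _ _ hi
  have hroot : ∀ c : k, ∃ b, b ^ p ^ m = c := fun c =>
    IsAlgClosed.exists_pow_nat_eq c (pow_pos hpp.out.pos m)
  choose b hb using hroot
  have hsum' : ∑ i ∈ s.filter (fun i => g i ≠ 0), g i • v ^ p ^ i = 0 := by
    rw [← hsum]
    refine Finset.sum_filter_of_ne fun i _ h h0 => h ?_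
    rw [h0, zero_smul]
  -- Let m be the lowest index occurring in a linear relation between the Frobenius twists of v.
  -- Taking p^m-th roots of the relation leaves v itself with a nonzero coefficient, and v can be
  -- solved for.
  have hlow : ∑ i ∈ s.filter (fun i => g i ≠ 0), b (g i) • v ^ p ^ (i - m) = 0 := by
    ext j
    have h1 := congrFun hsum' j
    simp only [Finset.sum_apply, Pi.smul_apply, Pi.pow_apply, smul_eq_mul, Pi.zero_apply] at h1 ⊢
    have h2 : (∑ i ∈ s.filter (fun i => g i ≠ 0), b (g i) * v j ^ p ^ (i - m)) ^ p ^ m = 0 := by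
      rw [sum_pow_char_pow]
      refine (Finset.sum_congr rfl fun i hi => ?_).trans h1
      rw [mul_pow, hb, ← pow_mul, ← pow_add, Nat.sub_add_cancel (hmin i hi)]
    exact eq_zero_of_pow_eq_zero h2
  rw [← Finset.add_sum_erase _ _ hms, Nat.sub_self, pow_zero, pow_one] at hlow
  have hbm : b (g m) ≠ 0 := fun h => by
    have := hb (g m)
    rw [h, zero_pow (pow_pos hpp.out.pos m).ne'] at this
    exact (Finset.mem_filter.1 hms).2 this.symm
  have hv : v = -((b (g m))⁻¹ • ∑ i ∈ (s.filter fun i => g i ≠ 0).erase m,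
      b (g i) • v ^ p ^ (i - m)) := by
    rw [eq_neg_of_add_eq_zero_right hlow, smul_neg, neg_neg, smul_smul, inv_mul_cancel₀ hbm,
      one_smul]
  rw [hv]
  refine neg_mem (Submodule.smul_mem _ _ (Submodule.sum_mem _ fun i hi => Submodule.smul_mem _ _ ?_))
  rw [← hv]
  refine Submodule.subset_span ⟨i - m - 1, ?_⟩
  have h1 := hmin i (Finset.mem_of_mem_erase hi)
  have h2 := Finset.ne_of_mem_erase hi
  have : i - m - 1 + 1 = i - m := by omega
  simp only [this]

/-- The element `∑ c_i z_i ∂_i` of the standard torus. -/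
def torusElt (r : ℕ) : (Fin n → k) →ₗ[k] W k p n := Fintype.linearCombination k (euler k p n r)

theorem torusElt_z (r : ℕ) (c : Fin n → k) (i : Fin n) :
    torusElt (p := p) r c (z k p n r i) = c i • z k p n r i := by
  have := sum_smul_partialDeriv_z (k := k) (p := p) r (fun i => c i • z k p n r i) i
  simp only [smul_assoc] at this
  exact this

theorem torusElt_mem (r : ℕ) (c : Fin n → k) : torusElt r c ∈ standardTorus k p n r :=
  mem_standardTorus.2 ⟨c, torusElt_z r c⟩

theorem exists_torusElt {r : ℕ} {D : W k p n} (h : D ∈ standardTorus k p n r) :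
    ∃ c, D = torusElt r c := by
  obtain ⟨c, hc⟩ := mem_standardTorus.1 h
  exact ⟨c, derivation_ext_z r fun i => by rw [hc, torusElt_z]⟩

theorem torusElt_injective (r : ℕ) : Function.Injective (torusElt (k := k) (p := p) (n := n) r) := by
  intro c d h
  ext i
  have := congrArg (fun D : W k p n => D (z k p n r i)) h
  simp only [torusElt_z] at this
  exact smul_left_injective k (z_ne_zero r i) this

theorem pMap_torusElt (r : ℕ) (c : Fin n → k) :
    pMap (torusElt r c) = torusElt (p := p) r (c ^ p) :=
  derivation_ext_z r fun i => by
    rw [pMap_apply_of_eigen (torusElt_z r c i), torusElt_z, Pi.pow_apply]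

theorem isTorus_standardTorus [IsAlgClosed k] (r : ℕ) : IsTorus (standardTorus k p n r) := by
  constructor
  · intro D hD E hE
    obtain ⟨c, rfl⟩ := exists_torusElt hD
    obtain ⟨d, rfl⟩ := exists_torusElt hE
    refine derivation_ext_z r fun i => ?_
    simp only [bracket_apply, torusElt_z, Derivation.map_smul, Derivation.zero_apply]
    rw [smul_comm, sub_self]
  · intro D hD
    obtain ⟨c, rfl⟩ := exists_torusElt hD
    rw [pMap_torusElt]
    exact torusElt_mem _ _
  · intro D hD
    obtain ⟨c, rfl⟩ := exists_torusElt hD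
    -- In the coordinates c the p-map is Frobenius on k^n, so semisimplicity reduces to
    -- `mem_span_frobenius`.
    have hit : ∀ i : ℕ, pMap^[i] (torusElt (p := p) r c) = torusElt r (c ^ p ^ i) := by
      intro i
      induction i with
      | zero => simp
      | succ i ih => rw [Function.iterate_succ_apply', ih, pMap_torusElt, ← pow_mul, pow_succ]
    have h := Submodule.mem_map_of_mem (f := torusElt (p := p) r) (mem_span_frobenius (p := p) c)
    rw [Submodule.map_span, ← Set.range_comp] at h
    have he : (⇑(torusElt (p := p) r) ∘ fun i : ℕ => c ^ p ^ (i + 1)) =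
        fun i : ℕ => pMap^[i + 1] (torusElt (p := p) r c) := funext fun i => (hit (i + 1)).symm
    rw [he] at h
    exact h

/-- The coordinates of such a D are roots of X^p - X. This finiteness is what later makes the
connected component of the normalizer act trivially. -/
theorem finite_toral_standardTorus (r : ℕ) :
    {D : W k p n | D ∈ standardTorus k p n r ∧ pMap D = D}.Finite := by
  classical
  have hf : {a : k | a ^ p = a}.Finite := by
    have h0 : (Polynomial.X ^ p - Polynomial.X : Polynomial k) ≠ 0 :=
      FiniteField.X_pow_card_sub_X_ne_zero k hpp.out.one_lt
    refine (Polynomial.X ^ p - Polynomial.X : Polynomial k).roots.toFinset.finite_toSet.subset ?_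
    intro a ha
    simp only [Finset.mem_coe, Multiset.mem_toFinset, Polynomial.mem_roots h0]
    simpa [sub_eq_zero] using ha
  refine ((Set.Finite.pi' fun _ : Fin n => hf).image (torusElt (p := p) r)).subset ?_
  rintro D ⟨hD, hD'⟩
  obtain ⟨c, rfl⟩ := exists_torusElt hD
  rw [pMap_torusElt] at hD'
  exact ⟨c, fun i => congrFun (torusElt_injective r hD') i, rfl⟩

theorem pMap_euler (r : ℕ) (i : Fin n) : pMap (euler k p n r i) = euler k p n r i :=
  derivation_ext_z r fun j => by
    have h : euler k p n r i (z k p n r j) = (if j = i then 1 else 0 : k) • z k p n r j := by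
      rw [euler_z]; split_ifs <;> simp
    rw [pMap_apply_of_eigen h, h]
    split_ifs <;> simp [hpp.out.ne_zero]

end StandardTorus

/-! ### An inverse function theorem for A(n). -/

section Automorphisms

variable {k : Type*} [Field k] {p n : ℕ} [hpp : Fact p.Prime] [CharP k p]

instance : FiniteDimensional k (TruncPoly k p n) := by
  refine Module.finite_def.2 ?_
  rw [← span_mono k 0]
  exact Submodule.fg_span (Set.finite_range _)

/-- The linear part at the origin of an element of `A(n)`. -/
def gradient : TruncPoly k p n →ₗ[k] (Fin n → k) :=
  LinearMap.pi fun i => (eval0 k p n).toLinearMap ∘ₗ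
    (partialDeriv k p n i : TruncPoly k p n →ₗ[k] TruncPoly k p n)

theorem gradient_apply (a : TruncPoly k p n) (i : Fin n) :
    gradient a i = eval0 k p n (partialDeriv k p n i a) := rfl

theorem gradient_x (i : Fin n) : gradient (x k p n i) = Pi.single i 1 := by
  ext j
  rw [gradient_apply, partialDeriv_x]
  by_cases h : i = j
  · subst h; simp
  · simp [h, Ne.symm h]

theorem gradient_algebraMap (c : k) : gradient (algebraMap k (TruncPoly k p n) c) = 0 := by
  ext j; rw [gradient_apply]; simp

/-- The maximal ideal of `A(n)`, as a vector space. -/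
def maxSpace (k : Type*) [Field k] (p n : ℕ) [Fact p.Prime] : Submodule k (TruncPoly k p n) :=
  LinearMap.ker (eval0 k p n).toLinearMap

theorem mem_maxSpace {a : TruncPoly k p n} : a ∈ maxSpace k p n ↔ eval0 k p n a = 0 := Iff.rfl

/-- This is the first-order Taylor expansion at the origin, with remainder in the square of the
maximal ideal. -/
theorem sub_linear_mem (a : TruncPoly k p n) :
    a - algebraMap k _ (eval0 k p n a) - ∑ i, gradient a i • x k p n i ∈
      maxSpace k p n * maxSpace k p n := by
  induction a using truncPoly_induction with
  | hC c => rw [gradient_algebraMap]; simp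
  | hadd a b ha hb =>
    convert add_mem ha hb using 1
    simp only [map_add, Pi.add_apply, add_smul, Finset.sum_add_distrib]
    ring
  | hX a j ha =>
    have h1 : gradient (a * x k p n j) = eval0 k p n a • Pi.single j 1 := by
      ext i
      rw [gradient_apply, Derivation.leibniz, smul_eq_mul, smul_eq_mul, map_add, map_mul, map_mul,
        eval0_x, zero_mul, add_zero, ← gradient_apply, gradient_x, Pi.smul_apply, smul_eq_mul]
    have h2 : ∑ i, gradient (a * x k p n j) i • x k p n i =
        algebraMap k _ (eval0 k p n a) * x k p n j := by
      rw [h1, Finset.sum_eq_single j]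
      · simp only [Pi.smul_apply, Pi.single_eq_same, smul_eq_mul, mul_one]
        exact Algebra.smul_def (eval0 k p n a) (x k p n j)
      · intro b _ hb; simp [hb]
      · simp
    rw [h2, map_mul, eval0_x, mul_zero, map_zero, sub_zero, ← sub_mul]
    refine Submodule.mul_mem_mul ?_ (mem_maxSpace.2 (eval0_x j))
    rw [mem_maxSpace]; simp

/-- By `pow_p` every element without constant term is nilpotent, and the nilradical of a noetherian
ring is nilpotent. -/
theorem maxSpace_nilpotent : ∃ N, maxSpace k p n ^ (N + 1) = ⊥ := by
  have : IsNoetherianRing (TruncPoly k p n) := inferInstance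
  obtain ⟨N, hN⟩ := IsNoetherianRing.isNilpotent_nilradical (TruncPoly k p n)
  have h : ∀ m, ∀ a ∈ maxSpace k p n ^ (m + 1), a ∈ nilradical (TruncPoly k p n) ^ (m + 1) := by
    intro m
    have h0 : ∀ a ∈ maxSpace k p n, a ∈ nilradical (TruncPoly k p n) := fun a ha =>
      mem_nilradical.2 ⟨p, by rw [pow_p, mem_maxSpace.1 ha]; simp [hpp.out.ne_zero]⟩
    induction m with
    | zero => simpa using h0
    | succ m ih =>
      intro a ha
      rw [pow_succ] at ha ⊢
      induction ha using Submodule.mul_induction_on' with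
      | mem_mul_mem b hb c hc => exact Ideal.mul_mem_mul (ih b hb) (h0 c hc)
      | add b _ c _ hb hc => exact add_mem hb hc
  refine ⟨N, (Submodule.eq_bot_iff _).2 fun a ha => ?_⟩
  have := h N a ha
  rw [pow_succ, hN] at this
  simpa using this

/-- A Nakayama argument by successive approximation: modulo M^(j+2), elements of M^(j+1) are sums of
(j+1)-fold products from V, which lie in S. The error eventually lands in M^(N+1) = 0. -/
theorem le_of_nilpotent {k A : Type*} [Field k] [CommRing A] [Algebra k A] {M V : Submodule k A}
    {S : Subalgebra k A} (hVM : V ≤ M) (hVS : V ≤ Subalgebra.toSubmodule S) (hMM : M * M ≤ M)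
    (h1 : M ≤ V ⊔ M * M) {N : ℕ} (hN : M ^ (N + 1) = ⊥) : M ≤ Subalgebra.toSubmodule S := by
  have h2 : ∀ j, M ^ (j + 1) ≤ V ^ (j + 1) ⊔ M ^ (j + 2) := by
    intro j
    induction j with
    | zero => rw [zero_add, zero_add, pow_one, pow_one, pow_two]; exact h1
    | succ j ih =>
      rw [pow_succ M (j + 1)]
      refine (mul_le_mul' ih h1).trans ?_
      rw [Submodule.sup_mul, Submodule.mul_sup, ← pow_succ]
      refine sup_le (sup_le le_sup_left (le_sup_of_le_right ?_)) (le_sup_of_le_right ?_)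
      · refine (mul_le_mul' (pow_le_pow_left' hVM _) le_rfl).trans ?_
        rw [← pow_two, ← pow_add]
      · refine (mul_le_mul' le_rfl (sup_le hVM hMM)).trans ?_
        rw [← pow_succ]
  have hVS' : ∀ j, V ^ (j + 1) ≤ Subalgebra.toSubmodule S := by
    intro j
    induction j with
    | zero => simpa using hVS
    | succ j ih =>
      rw [pow_succ]
      exact Submodule.mul_le.2 fun a ha b hb => S.mul_mem (ih ha) (hVS hb)
  have h3 : ∀ j, M ≤ Subalgebra.toSubmodule S ⊔ M ^ (j + 1) := by
    intro j
    induction j with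
    | zero => simp
    | succ j ih =>
      exact ih.trans (sup_le le_sup_left ((h2 j).trans (sup_le_sup_right (hVS' j) _)))
  simpa [hN] using h3 N

/-- The Jacobian matrix at the origin is invertible, so the images of the generators span the
maximal ideal modulo its square, and `le_of_nilpotent` puts the whole maximal ideal in the range. -/
theorem algHom_surjective {φ : TruncPoly k p n →ₐ[k] TruncPoly k p n}
    (h0 : ∀ i, eval0 k p n (φ (x k p n i)) = 0)
    (hspan : ⊤ ≤ Submodule.span k (Set.range fun i => gradient (φ (x k p n i)))) :
    Function.Surjective φ := by
  set M := maxSpace k p n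
  set V : Submodule k (TruncPoly k p n) := Submodule.span k (Set.range fun i => φ (x k p n i))
  set S : Submodule k (TruncPoly k p n) := Subalgebra.toSubmodule φ.range
  have hVM : V ≤ M := Submodule.span_le.2 (by rintro _ ⟨i, rfl⟩; exact h0 i)
  have hVS : V ≤ S := Submodule.span_le.2 (by rintro _ ⟨i, rfl⟩; exact ⟨_, rfl⟩)
  have h1 : M ≤ V ⊔ M * M := by
    intro a ha
    have hg : gradient a ∈ Submodule.span k (Set.range fun i => gradient (φ (x k p n i))) :=
      hspan trivial
    obtain ⟨c, hc⟩ := (Submodule.mem_span_range_iff_exists_fun k).1 hg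
    have hb : ∑ i, c i • φ (x k p n i) ∈ V :=
      Submodule.sum_mem _ fun i _ => Submodule.smul_mem _ _ (Submodule.subset_span ⟨i, rfl⟩)
    rw [← add_sub_cancel (∑ i, c i • φ (x k p n i)) a]
    refine Submodule.add_mem_sup hb ?_
    have hs := sub_linear_mem (a - ∑ i, c i • φ (x k p n i))
    have hgr : gradient (a - ∑ i, c i • φ (x k p n i)) = 0 := by
      rw [map_sub, map_sum, ← hc, sub_eq_zero]
      exact Finset.sum_congr rfl fun i _ => (map_smul _ _ _).symm
    have he : eval0 k p n (a - ∑ i, c i • φ (x k p n i)) = 0 :=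
      M.sub_mem ha (hVM hb)
    rw [hgr, he] at hs
    simpa using hs
  obtain ⟨N, hN⟩ := maxSpace_nilpotent (k := k) (p := p) (n := n)
  have h4 : M ≤ S := le_of_nilpotent hVM hVS (Submodule.mul_le.2 fun a _ b hb => by
    rw [mem_maxSpace, map_mul, mem_maxSpace.1 hb, mul_zero]) h1 hN
  intro a
  have h5 : a - algebraMap k _ (eval0 k p n a) ∈ φ.range := h4 (by rw [mem_maxSpace]; simp)
  have h6 := φ.range.add_mem h5 (φ.range.algebraMap_mem (eval0 k p n a))
  rwa [sub_add_cancel] at h6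

end Automorphisms

/-! ### Diagonalisation of tori and Demushkin's theorem. -/

section Demushkin

variable {k : Type*} [Field k] [IsAlgClosed k] {p n : ℕ} [hpp : Fact p.Prime] [CharP k p]

/-- T is a root of X - Σ c_i X^(p^(i+1)), which has derivative 1 and is therefore separable. -/
theorem _root_.Module.End.isSemisimple_of_mem_span_frobenius {V : Type*} [AddCommGroup V]
    [Module k V] [FiniteDimensional k V] {T : Module.End k V}
    (hT : T ∈ Submodule.span k (Set.range fun i : ℕ => T ^ p ^ (i + 1))) : T.IsSemisimple := by
  obtain ⟨c, hc⟩ := (Finsupp.mem_span_range_iff_exists_finsupp).1 hT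
  set q : Polynomial k := Polynomial.X -
    c.sum fun i a => Polynomial.C a * Polynomial.X ^ p ^ (i + 1) with hqdef
  have hq : q.Separable := by
    have : Polynomial.derivative q = 1 := by
      simp only [q, Polynomial.derivative_sub, Polynomial.derivative_X, Finsupp.sum,
        Polynomial.derivative_sum, Polynomial.derivative_C_mul, Polynomial.derivative_X_pow]
      rw [Finset.sum_eq_zero, sub_zero]
      intro i _
      simp
    rw [Polynomial.separable_def, this]
    exact isCoprime_one_right
  refine Module.End.isSemisimple_of_squarefree_aeval_eq_zero hq.squarefree ?_
  rw [hqdef, map_sub, Polynomial.aeval_X, sub_eq_zero]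
  conv_lhs => rw [← hc]
  simp only [Finsupp.sum, map_sum, map_mul, Polynomial.aeval_C, map_pow, Polynomial.aeval_X,
    Algebra.smul_def]

/-- Commuting operators over an algebraically closed field have joint generalized eigenspaces that
span; semisimplicity turns these into genuine eigenspaces. -/
theorem _root_.Module.End.span_common_eigenvectors {V : Type*} [AddCommGroup V] [Module k V]
    [FiniteDimensional k V] {ι : Type*} (f : ι → Module.End k V) (hf : ∀ i, (f i).IsSemisimple)
    (hc : ∀ i j, Commute (f i) (f j)) :
    Submodule.span k {a : V | ∀ i, ∃ c : k, f i a = c • a} = ⊤ := by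
  have htop := Module.End.iSup_iInf_maxGenEigenspace_eq_top_of_iSup_maxGenEigenspace_eq_top_of_commute
    f (fun i j _ => hc i j) fun i => Module.End.iSup_maxGenEigenspace_eq_top _
  rw [eq_top_iff, ← htop, iSup_le_iff]
  intro χ a ha
  refine Submodule.subset_span fun i => ⟨χ i, ?_⟩
  rw [Submodule.mem_iInf] at ha
  have := ha i
  rwa [(hf i).isFinitelySemisimple.maxGenEigenspace_eq_eigenspace,
    Module.End.mem_eigenspace_iff] at this

/-- The inclusion of `W(n)` into the endomorphisms of `A(n)`. -/
def toEnd (k : Type*) [Field k] (p n : ℕ) : W k p n →ₗ[k] Module.End k (TruncPoly k p n) where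
  toFun D := D
  map_add' _ _ := rfl
  map_smul' _ _ := rfl

theorem toEnd_pMap_iterate (D : W k p n) (i : ℕ) :
    toEnd k p n (pMap^[i] D) = toEnd k p n D ^ p ^ i := by
  induction i with
  | zero => simp
  | succ i ih =>
    rw [Function.iterate_succ_apply', pow_succ, pow_mul, ← ih]
    rfl

/-- The elements of `A(n)` which are homogeneous for the action of a torus span `A(n)`. -/
theorem IsTorus.span_homogeneous {t : Submodule k (W k p n)} (ht : IsTorus t) :
    Submodule.span k {a : TruncPoly k p n | ∀ D ∈ t, ∃ c : k, D a = c • a} = ⊤ := by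
  rw [← Module.End.span_common_eigenvectors (fun D : t => toEnd k p n D) ?_ ?_]
  · congr 1
    ext a
    exact ⟨fun h D => h D D.2, fun h D hD => h ⟨D, hD⟩⟩
  · intro D
    have h := Submodule.mem_map_of_mem (f := toEnd k p n) (ht.semisimple D D.2)
    rw [Submodule.map_span, ← Set.range_comp] at h
    have he : (⇑(toEnd k p n) ∘ fun i : ℕ => pMap^[i + 1] (D : W k p n)) =
        fun i : ℕ => toEnd k p n D ^ p ^ (i + 1) := funext fun i => toEnd_pMap_iterate _ _
    rw [he] at h
    exact Module.End.isSemisimple_of_mem_span_frobenius h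
  · intro D E
    refine LinearMap.ext fun a => ?_
    have := congrArg (fun F : W k p n => F a) (ht.abelian D D.2 E E.2)
    simp only [bracket_apply] at this
    exact sub_eq_zero.1 this

theorem exists_perm_of_pred (q : Fin n → Prop) :
    ∃ r ≤ n, ∃ σ : Equiv.Perm (Fin n), ∀ i : Fin n, q (σ i) ↔ (i : ℕ) < r := by
  classical
  have hr : Fintype.card {i // q i} ≤ n := by simpa using Fintype.card_subtype_le q
  refine ⟨Fintype.card {i // q i}, hr, ?_⟩
  have hc : Fintype.card {i : Fin n // (i : ℕ) < Fintype.card {i // q i}} =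
      Fintype.card {i // q i} := by
    conv_rhs => rw [← Fintype.card_fin (Fintype.card {i // q i})]
    exact Fintype.card_congr ⟨fun i => ⟨i.1, i.2⟩, fun i => ⟨⟨i.1, i.2.trans_le hr⟩, i.2⟩,
      fun _ => rfl, fun _ => rfl⟩
  let e := Fintype.equivOfCardEq hc
  refine ⟨e.extendSubtype, fun i => ⟨fun h => ?_, fun h => e.extendSubtype_mem i h⟩⟩
  by_contra hi
  exact e.extendSubtype_not_mem i hi h

/-- Demushkin's theorem: every maximal torus of `W(n)` is conjugate to a standard torus. -/
theorem IsMaximalTorus.exists_conj {t : Submodule k (W k p n)} (ht : IsMaximalTorus t) :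
    ∃ r ≤ n, ∃ g : G k p n, g • standardTorus k p n r = t := by
  classical
  set S := {a : TruncPoly k p n | ∀ D ∈ t, ∃ c : k, D a = c • a} with hS
  have hspan : ⊤ ≤ Submodule.span k (gradient '' S) := by
    rw [← Submodule.map_span, ht.prop.span_homogeneous, Submodule.map_top]
    intro v _
    refine ⟨∑ i, v i • x k p n i, ?_⟩
    rw [map_sum]
    ext j
    rw [Finset.sum_apply, Finset.sum_eq_single j]
    · rw [map_smul, gradient_x]; simp
    · intro i _ hi; rw [map_smul, gradient_x]; simp [hi.symm]
    · simp
  -- The basis is extracted from the spanning set, so each basis vector is the gradient of a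
  -- homogeneous element.
  let B := Module.Basis.ofSpan hspan
  let b : Module.Basis (Fin n) k (Fin n → k) := B.reindex (Fintype.equivOfCardEq (by
    rw [← Module.finrank_eq_card_basis B, Module.finrank_fin_fun, Fintype.card_fin]))
  have hb : ∀ i, ∃ a ∈ S, gradient a = b i := fun i => by
    have : b i ∈ Set.range B := by simp [b]
    exact Module.Basis.ofSpan_subset hspan this
  choose a haS ha using hb
  -- The integer r counts the chosen eigenvectors with nonzero constant term. They are put first and
  -- scaled by u to constant term 1, so that the y_i have the same constant terms as the z_i.
  obtain ⟨r, hr, σ, hσ⟩ := exists_perm_of_pred fun i => eval0 k p n (a i) ≠ 0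
  let u : Fin n → kˣ := fun i => if h : eval0 k p n (a i) ≠ 0 then (Units.mk0 _ h)⁻¹ else 1
  let y : Fin n → TruncPoly k p n := fun i => (u (σ i) : k) • a (σ i)
  have hy0 : ∀ i, eval0 k p n (y i) = if (i : ℕ) < r then 1 else 0 := fun i => by
    simp only [y, u, map_smul, smul_eq_mul]
    by_cases h : (i : ℕ) < r
    · have := (hσ i).2 h
      simp [h, this]
    · have : eval0 k p n (a (σ i)) = 0 := by
        by_contra h'
        exact h ((hσ i).1 h')
      simp [h, this]
  have hp : ∀ i, (y i - algebraMap k _ (eval0 k p n (y i))) ^ p = 0 := fun i => by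
    rw [pow_p]; simp [hpp.out.ne_zero]
  let φ : TruncPoly k p n →ₐ[k] TruncPoly k p n :=
    liftHom (fun i => y i - algebraMap k _ (eval0 k p n (y i))) hp
  have hφx : ∀ i, φ (x k p n i) = y i - algebraMap k _ (eval0 k p n (y i)) := liftHom_x _ hp
  have hφz : ∀ i, φ (z k p n r i) = y i := fun i => by
    unfold z
    split_ifs with h
    · rw [map_add, map_one, hφx, hy0, if_pos h]; simp
    · rw [hφx, hy0, if_neg h]; simp
  have hsurj : Function.Surjective φ := by
    refine algHom_surjective (fun i => by rw [hφx]; simp) ?_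
    have hg : ∀ i, gradient (φ (x k p n i)) = (b.unitsSMul u).reindex σ.symm i := fun i => by
      rw [hφx, map_sub, gradient_algebraMap, sub_zero, map_smul, ha]
      simp [Module.Basis.unitsSMul_apply, Units.smul_def]
    simp only [hg]
    exact ((b.unitsSMul u).reindex σ.symm).span_eq.ge
  have hinj : Function.Injective φ :=
    (LinearMap.injective_iff_surjective (f := φ.toLinearMap)).2 hsurj
  let Φ := AlgEquiv.ofBijective φ ⟨hinj, hsurj⟩
  refine ⟨r, hr, conjG Φ, ?_⟩
  symm
  -- By maximality only one inclusion is needed: every D in t acts diagonally on the y_i, the images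
  -- of the z_i.
  refine Maximal.eq_of_le ht ((isTorus_standardTorus r).smul _) fun D hD => ?_
  rw [mem_smul_iff_inv, ← map_inv, mem_standardTorus]
  have : ∀ i, ∃ c : k, (conjG Φ⁻¹).1 D (z k p n r i) = c • z k p n r i := fun i => by
    obtain ⟨c, hc⟩ := haS (σ i) D hD
    refine ⟨c, ?_⟩
    change Φ.symm (D (Φ (z k p n r i))) = _
    have h1 : Φ (z k p n r i) = y i := hφz i
    rw [h1]
    have h2 : D (y i) = c • y i := by
      simp only [y]; rw [Derivation.map_smul, hc, smul_comm]
    rw [h2, map_smul, ← h1, AlgEquiv.symm_apply_apply]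
  choose c hc using this
  exact ⟨c, hc⟩

end Demushkin

/-! ### Rigidity of the families of linear maps that arise when r = n. -/

section Rigidity

variable {k : Type*} [Field k] {p n : ℕ} [hpp : Fact p.Prime] [CharP k p]

/-- The value at `h ∈ k^n` of the linear form with coefficients `a` in the prime field. -/
def pair (k : Type*) [Field k] {p n : ℕ} [Fact p.Prime] [CharP k p] (a : Fin n → ZMod p) :
    (Fin n → k) →ₗ[k] k := Fintype.linearCombination k fun i => fp k p (a i)

theorem pair_apply (a : Fin n → ZMod p) (h : Fin n → k) :
    pair k a h = ∑ i, h i * fp k p (a i) := rfl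

@[simp] theorem pair_zero (h : Fin n → k) : pair k (0 : Fin n → ZMod p) h = 0 := by
  simp [pair_apply]

theorem pair_add (a b : Fin n → ZMod p) (h : Fin n → k) :
    pair k (a + b) h = pair k a h + pair k b h := by
  simp [pair_apply, mul_add, Finset.sum_add_distrib]

theorem pair_neg (a : Fin n → ZMod p) (h : Fin n → k) : pair k (-a) h = -pair k a h := by
  simp [pair_apply]

theorem pair_single (i : Fin n) (h : Fin n → k) :
    pair k (Pi.single i 1 : Fin n → ZMod p) h = h i := by
  rw [pair_apply, Finset.sum_eq_single i]
  · simp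
  · intro j _ hj; simp [hj]
  · simp

theorem pair_single_right (a : Fin n → ZMod p) (i : Fin n) (c : k) :
    pair k a (Pi.single i c) = c * fp k p (a i) := by
  rw [pair_apply, Finset.sum_eq_single i]
  · simp
  · intro j _ hj; simp [hj]
  · simp

theorem two_ne_zero_of_three_le (hp : 3 ≤ p) : (2 : k) ≠ 0 := by
  intro h
  have : ((2 : ℕ) : k) = 0 := by exact_mod_cast h
  rw [CharP.cast_eq_zero_iff k p] at this
  exact absurd (Nat.le_of_dvd two_pos this) (by omega)

/-- Here `g a` is the action of an automorphism on the weight space of a, `hg` expresses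
compatibility with the bracket and `hP` compatibility with the p-map. Pairing a with -a lands in
weight 0, where the action is trivial; this shows that `g a` preserves the linear form a and fixes
its kernel. One transverse vector per weight remains, and it is controlled by comparing two
independent weights. -/
theorem rigidity_of_two_le (hp : 3 ≤ p) (hn : 2 ≤ n)
    (g : (Fin n → ZMod p) → Module.End k (Fin n → k)) (h0 : g 0 = 1)
    (hinj : ∀ a, Function.Injective (g a))
    (hg : ∀ a b h h', pair k b h • g (a + b) h' - pair k a h' • g (a + b) h =
      pair k b (g a h) • g b h' - pair k a (g b h') • g a h)
    (hP : ∀ a h, pair k a h = 0 → pair k a (g a h) = 0 → g a h = h) : ∀ a, g a = 1 := by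
  have h2 : (2 : k) ≠ 0 := two_ne_zero_of_three_le hp
  have hneg : ∀ a h h', -(pair k a h) • h' - pair k a h' • h =
      -(pair k a (g a h)) • g (-a) h' - pair k a (g (-a) h') • g a h := fun a h h' => by
    have := hg a (-a) h h'
    simpa only [add_neg_cancel, h0, Module.End.one_apply, pair_neg] using this
  -- With h' = h the left side of `hneg` vanishes. Applying a to the right side gives 2 a(g_a h)
  -- a(g_{-a} h) = 0, and if the first factor were nonzero then g_{-a} h = 0, against injectivity.
  have hker : ∀ a h, pair k a h = 0 → pair k a (g a h) = 0 := by
    intro a h hh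
    by_contra hA
    have h1 := hneg a h h
    rw [hh, neg_zero, zero_smul, sub_zero] at h1
    have h3 := congrArg (pair k a) h1
    simp only [map_zero, map_sub, map_smul, smul_eq_mul] at h3
    have h4 : pair k a (g (-a) h) = 0 := by
      have : (2 : k) * pair k a (g a h) * pair k a (g (-a) h) = 0 := by linear_combination h3
      simpa [h2, hA] using this
    rw [h4, zero_smul, sub_zero, eq_comm, smul_eq_zero_iff_right (neg_ne_zero.2 hA)] at h1
    rw [hinj (-a) (h1.trans (map_zero _).symm)] at hA
    simp at hA
  have hfix : ∀ a h, pair k a h = 0 → g a h = h := fun a h hh => hP a h hh (hker a h hh)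
  have hex : ∀ a : Fin n → ZMod p, ∃ h, h ≠ 0 ∧ pair k a h = 0 := by
    intro a
    by_cases ha : a ⟨0, by omega⟩ = 0
    · exact ⟨Pi.single ⟨0, by omega⟩ 1, by simp, by rw [pair_single_right, ha]; simp⟩
    · refine ⟨Pi.single ⟨0, by omega⟩ (fp k p (a ⟨1, by omega⟩)) -
        Pi.single ⟨1, by omega⟩ (fp k p (a ⟨0, by omega⟩)), fun h => ha ?_, ?_⟩
      · have := congrFun h ⟨1, by omega⟩
        simpa using this
      · rw [map_sub, pair_single_right, pair_single_right]; ring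
  have hpres : ∀ a h, pair k a (g a h) = pair k a h := by
    intro a h
    obtain ⟨v, hv, hv'⟩ := hex a
    have h1 := hneg (-a) v h
    rw [neg_neg, pair_neg, pair_neg, hfix (-a) v (by rw [pair_neg, hv', neg_zero]), pair_neg,
      pair_neg, hv', neg_zero, neg_zero, zero_smul, zero_smul, zero_sub, zero_sub, neg_smul,
      neg_smul, neg_neg, neg_neg] at h1
    exact (smul_left_injective k hv h1).symm
  have hsub : ∀ a v, pair k a v = 1 → g (-a) v = 2 • v - g a v := by
    intro a v hv
    have h1 := hneg a v v
    have h3 : pair k a (g (-a) v) = 1 := by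
      have := hpres (-a) v
      rw [pair_neg, pair_neg, hv] at this
      linear_combination -this
    rw [hpres, hv, h3, neg_one_smul, one_smul, neg_one_smul, one_smul] at h1
    linear_combination h1
  -- Both g_{a+b}(va) and g_{a+b}(vb) are computed from `hg`, and g_{a+b} fixes va - vb because a +
  -- b vanishes on it.
  have hthree : ∀ a b va vb, pair k a va = 1 → pair k b va = 0 → pair k a vb = 0 →
      pair k b vb = 1 → (g a va - va) - pair k b (g a va) • va =
        (g b vb - vb) - pair k a (g b vb) • vb := by
    intro a b va vb haa hba hab hbb
    have h1 := hg a b vb vb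
    rw [hbb, hab, zero_smul, one_smul, sub_zero, hfix a vb hab, hbb, one_smul] at h1
    have h3 := hg a b va va
    rw [hba, haa, zero_smul, one_smul, zero_sub, hfix b va hba, haa, one_smul] at h3
    have h4 := hfix (a + b) (va - vb) (by
      rw [map_sub, pair_add, pair_add, haa, hba, hab, hbb]; ring)
    rw [map_sub, h1, neg_eq_iff_eq_neg.1 h3] at h4
    linear_combination h4
  have hindep : ∀ a b va vb, pair k a va = 1 → pair k b va = 0 → pair k a vb = 0 →
      pair k b vb = 1 → pair k a (g b vb - vb) = 0 := by
    intro a b va vb haa hba hab hbb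
    have h1 := hthree a b va vb haa hba hab hbb
    -- Replacing (b, vb) by (-b, -vb) leaves the displacements g v - v unchanged but flips the sign
    -- of the correction terms. Adding the two identities shows that both displacements agree, and a
    -- kills the first one.
    have h3 := hthree a (-b) va (-vb) haa (by rw [pair_neg, hba, neg_zero])
      (by rw [map_neg, hab, neg_zero]) (by rw [map_neg, pair_neg, hbb, neg_neg])
    rw [pair_neg, map_neg (g (-b)), hsub b vb hbb, map_neg, map_sub, map_nsmul, hab] at h3
    have h4 : (2 : k) • (g a va - va) = (2 : k) • (g b vb - vb) := by
      rw [two_smul, two_smul]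
      have := congrArg₂ (· + ·) h1 h3
      simp only [nsmul_zero, zero_sub, neg_neg, neg_smul, smul_neg] at this
      rw [two_nsmul] at this
      linear_combination this
    rw [← smul_right_injective _ h2 h4, map_sub, hpres, sub_self]
  intro b
  by_cases hb : b = 0
  · rw [hb, h0]
  obtain ⟨i₀, hi₀⟩ := Function.ne_iff.1 hb
  have hi₀' : fp k p (b i₀) ≠ 0 := by simpa using hi₀
  set vb : Fin n → k := Pi.single i₀ (fp k p (b i₀))⁻¹ with hvb
  have hbb : pair k b vb = 1 := by rw [hvb, pair_single_right, inv_mul_cancel₀ hi₀']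
  have hu : ∀ i, i ≠ i₀ → (g b vb - vb) i = 0 := by
    intro i hi
    -- The coordinate form ε_i serves as the second weight; the witness is e_i corrected along
    -- e_{i₀} so as to lie in the kernel of b.
    have := hindep (Pi.single i 1) b
      (Pi.single i 1 - Pi.single i₀ (fp k p (b i) * (fp k p (b i₀))⁻¹)) vb
      (by rw [pair_single]; simp [hi])
      (by rw [map_sub, pair_single_right, pair_single_right]; field_simp; ring)
      (by rw [pair_single, hvb]; simp [hi]) hbb
    rwa [pair_single] at this
  have hu0 : g b vb - vb = 0 := by
    ext i
    by_cases hi : i = i₀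
    · subst hi
      have h1 : pair k b (g b vb - vb) = 0 := by rw [map_sub, hpres, sub_self]
      rw [pair_apply, Finset.sum_eq_single i] at h1
      · exact (mul_eq_zero.1 h1).resolve_right hi₀'
      · intro j _ hj; rw [hu j hj, zero_mul]
      · simp
    · exact hu i hi
  refine LinearMap.ext fun h => ?_
  have h1 := hfix b (h - pair k b h • vb) (by rw [map_sub, map_smul, hbb]; simp)
  rw [map_sub, map_smul, sub_eq_zero.1 hu0] at h1
  exact sub_left_injective h1

/-- Multiplicativity fails to give c(2) = c(1)^2 directly. That value comes from the pairs (1, -1)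
and (2, -1), which are distinct because p is at least 5. Then c is a character of Z/p in
characteristic p, and c(1)^p = 1 forces c(1) = 1. -/
theorem character_eq_one {c : ZMod p → k} (hp : 5 ≤ p) (h0 : c 0 = 1)
    (hc : ∀ a b, a ≠ b → c (a + b) = c a * c b) : ∀ a, c a = 1 := by
  have hne : ∀ m : ℕ, 0 < m → m < p → (m : ZMod p) ≠ 0 := fun m h1 h2 h => by
    rw [ZMod.natCast_eq_zero_iff] at h
    exact absurd (Nat.le_of_dvd h1 h) (by omega)
  have h2 : (2 : ZMod p) ≠ 0 := by exact_mod_cast hne 2 (by omega) (by omega)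
  have h3 : (3 : ZMod p) ≠ 0 := by exact_mod_cast hne 3 (by omega) (by omega)
  have e1 : c 1 * c (-1) = 1 := by
    rw [← hc 1 (-1) fun h => h2 (by linear_combination h), add_neg_cancel, h0]
  have e2 : c 2 * c (-1) = c 1 := by
    rw [← hc 2 (-1) fun h => h3 (by linear_combination h)]; congr 1; ring
  have e3 : c 2 = c 1 * c 1 := by linear_combination c 2 * (-e1) + c 1 * e2
  have hm : ∀ m : ℕ, c m = c 1 ^ m := by
    intro m
    induction m with
    | zero => simpa using h0
    | succ m ih =>
      rw [pow_succ, ← ih, Nat.cast_succ]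
      by_cases h : (m : ZMod p) = 1
      · rw [h, ← e3]; congr 1; norm_num
      · exact hc _ _ h
  have h1 : c 1 = 1 := by
    have := hm p
    rw [CharP.cast_eq_zero, h0] at this
    refine frobenius_inj k p ?_
    rw [frobenius_def, frobenius_def, one_pow, this]
  intro a
  rw [← ZMod.natCast_zmod_val a, hm, h1, one_pow]

end Rigidity

/-! ### Weights and the centralizer of a standard torus. -/

section Centralizer

variable {k : Type*} [Field k] {p n : ℕ} [hpp : Fact p.Prime] [CharP k p]

theorem centralizer_weight {r : ℕ} {g : G k p n} (hg : g ∈ centralizer (standardTorus k p n r))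
    {E : W k p n} {w : Fin n → ZMod p}
    (hE : ∀ j, ⁅euler k p n r j, E⁆ = fp k p (w j) • E) (j : Fin n) :
    ⁅euler k p n r j, g.1 E⁆ = fp k p (w j) • g.1 E := by
  have h := (mem_centralizer _ _).1 hg _ (euler_mem_standardTorus r j)
  rw [← h, ← G_bracket, hE, map_smul]

/-- An element of the centralizer of the standard torus maps a derivation of weight `w` to one of
weight `w`. -/
theorem centralizer_exists_form {r : ℕ} {g : G k p n}
    (hg : g ∈ centralizer (standardTorus k p n r)) (a : Fin n → ZMod p) (i : Fin n) :
    ∃ c : Fin n → k, ∀ l, g.1 (mono k r a • partialDeriv k p n i) (z k p n r l) =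
      c l • mono k r (a - Pi.single i 1 + Pi.single l 1) :=
  exists_weight_form r _ (centralizer_weight hg fun j => euler_bracket_mono r i j a)

theorem eq_one_of_fixes_mono (r : ℕ) {g : G k p n}
    (h : ∀ (a : Fin n → ZMod p) (i : Fin n),
      g.1 (mono k r a • partialDeriv k p n i) = mono k r a • partialDeriv k p n i) : g = 1 := by
  have h1 : ∀ (f : TruncPoly k p n) i, g.1 (f • partialDeriv k p n i) = f • partialDeriv k p n i := by
    intro f i
    have hf : f ∈ Submodule.span k (Set.range (mono k r)) := by rw [span_mono]; trivial
    induction hf using Submodule.span_induction with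
    | mem f hf => obtain ⟨a, rfl⟩ := hf; exact h a i
    | zero =>
      have : (0 : TruncPoly k p n) • partialDeriv k p n i = 0 := by
        ext f; rw [Derivation.smul_apply, smul_eq_mul, zero_mul, Derivation.zero_apply]
      rw [this, map_zero]
    | add a b _ _ ha hb => rw [add_smul, map_add, ha, hb]
    | smul c a _ ha => rw [smul_assoc, map_smul, ha]
  refine Subtype.ext (LinearEquiv.ext fun D => ?_)
  change g.1 D = D
  conv_lhs => rw [eq_sum_smul_partialDeriv r D]
  conv_rhs => rw [eq_sum_smul_partialDeriv r D]
  rw [map_sum]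
  exact Finset.sum_congr rfl fun i _ => h1 _ i

theorem torusElt_mono (r : ℕ) (h : Fin n → k) (a : Fin n → ZMod p) :
    torusElt r h (mono k r a) = pair k a h • mono k r a := by
  have h1 : torusElt r h (mono k r a) = ∑ i, h i • euler k p n r i (mono k r a) := by
    change toEnd k p n (∑ i, h i • euler k p n r i) (mono k r a) = _
    rw [map_sum, LinearMap.sum_apply]
    exact Finset.sum_congr rfl fun i _ => by rw [map_smul]; rfl
  rw [h1, pair_apply, Finset.sum_smul]
  exact Finset.sum_congr rfl fun i _ => by rw [euler_mono, smul_smul]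

/-- The derivation `mono a • ∑ h_i z_i ∂_i`, which has weight `a`. -/
def weightElt (k : Type*) [Field k] {p n : ℕ} [Fact p.Prime] [CharP k p] (r : ℕ)
    (a : Fin n → ZMod p) : (Fin n → k) →ₗ[k] W k p n where
  toFun h := mono k r a • torusElt r h
  map_add' h h' := by rw [map_add, smul_add]
  map_smul' c h := by rw [map_smul, smul_comm, RingHom.id_apply]

theorem weightElt_apply (r : ℕ) (a : Fin n → ZMod p) (h : Fin n → k) (f : TruncPoly k p n) :
    weightElt k r a h f = mono k r a * torusElt r h f := rfl

theorem weightElt_zero (r : ℕ) (h : Fin n → k) :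
    weightElt k r (0 : Fin n → ZMod p) h = torusElt r h := by
  ext f; rw [weightElt_apply, mono_zero, one_mul]

theorem derivation_ext_mono (r : ℕ) {D E : W k p n}
    (h : ∀ i, D (mono k r (Pi.single i 1)) = E (mono k r (Pi.single i 1))) : D = E :=
  derivation_ext_z r fun i => by simpa only [mono_single] using h i

/-! ### The case r = n: all z_i are units and weight spaces are translates of the torus. -/

section FullRank

theorem mono_mul_mono' (a b : Fin n → ZMod p) : mono k n a * mono k n b = mono k n (a + b) :=
  mono_mul_mono k fun i hi => absurd i.2 (by omega)

theorem weightElt_mono (a b : Fin n → ZMod p) (h : Fin n → k) :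
    weightElt k n a h (mono k n b) = pair k b h • mono k n (a + b) := by
  rw [weightElt_apply, torusElt_mono, mul_smul_comm, mono_mul_mono']

theorem weightElt_injective (a : Fin n → ZMod p) : Function.Injective (weightElt k n a) := by
  intro h h' e
  ext i
  have := congrArg (fun D : W k p n => D (mono k n (Pi.single i 1))) e
  simp only [weightElt_mono, pair_single] at this
  exact smul_left_injective k (mono_ne_zero _ _) this

theorem weightElt_bracket (a b : Fin n → ZMod p) (h h' : Fin n → k) :
    ⁅weightElt k n a h, weightElt k n b h'⁆ =
      weightElt k n (a + b) (pair k b h • h' - pair k a h' • h) := by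
  refine derivation_ext_mono n fun i => ?_
  rw [bracket_apply]
  simp only [weightElt_mono, Derivation.map_smul, smul_smul, pair_add, map_sub (pair k _),
    map_smul (pair k _), smul_eq_mul]
  rw [show a + (b + Pi.single i 1) = a + b + Pi.single i 1 by abel,
    show b + (a + Pi.single i 1) = a + b + Pi.single i 1 by abel, ← sub_smul]
  congr 1
  ring

/-- Since a(h) = 0, the torus element h kills z^a, so the p-th power is z^(pa) h^p, and pa = 0. -/
theorem pMap_weightElt {a : Fin n → ZMod p} {h : Fin n → k} (hh : pair k a h = 0) :
    pMap (weightElt k n a h) = torusElt n (h ^ p) := by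
  refine derivation_ext_mono n fun i => ?_
  have : ∀ m : ℕ, ((weightElt k n a h : Module.End k (TruncPoly k p n)) ^ m)
      (mono k n (Pi.single i 1)) = h i ^ m • mono k n (m • a + Pi.single i 1) := by
    intro m
    have hm : pair k (m • a + Pi.single i 1) h = h i := by
      rw [pair_add, pair_single]
      have : pair k (m • a) h = 0 := by
        induction m with
        | zero => simp
        | succ m ih => rw [succ_nsmul, pair_add, ih, hh, add_zero]
      rw [this, zero_add]
    induction m with
    | zero => simp
    | succ m ih =>
      have hm' : pair k (m • a + Pi.single i 1) h = h i := by
        rw [succ_nsmul, pair_add, pair_add, hh, add_zero] at hm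
        rw [pair_add]; exact hm
      rw [pow_succ', Module.End.mul_apply, ih hm', map_smul, Derivation.coeFn_coe, weightElt_mono,
        hm', smul_smul, ← pow_succ]
      congr 2
      rw [succ_nsmul]; abel
  rw [pMap_apply, this p, torusElt_mono, pair_single, Pi.pow_apply]
  have hpa : p • a = 0 := by ext j; simp
  rw [hpa, zero_add]

theorem weightElt_single (a : Fin n → ZMod p) (i : Fin n) :
    mono k n a • partialDeriv k p n i = weightElt k n (a - Pi.single i 1) (Pi.single i 1) := by
  refine derivation_ext_mono n fun l => ?_
  rw [weightElt_mono, pair_single, Derivation.smul_apply, mono_single, partialDeriv_z]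
  by_cases h : l = i
  · subst h; simp
  · simp [h]

theorem exists_weightElt_of_weight (a : Fin n → ZMod p) {E : W k p n}
    (hE : ∀ j, ⁅euler k p n n j, E⁆ = fp k p (a j) • E) : ∃ c, E = weightElt k n a c := by
  obtain ⟨c, hc⟩ := exists_weight_form n a hE
  refine ⟨c, derivation_ext_z n fun i => ?_⟩
  rw [hc, ← mono_single, weightElt_mono, pair_single]

theorem euler_eq_weightElt (j : Fin n) :
    euler k p n n j = weightElt k n (0 : Fin n → ZMod p) (Pi.single j 1) := by
  refine derivation_ext_mono n fun l => ?_
  rw [weightElt_mono, pair_single, euler_mono, zero_add, Pi.single_apply, Pi.single_apply]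
  by_cases h : l = j
  · subst h; simp
  · simp [h, Ne.symm h]

/-- The automorphism acts on the weight space z^a t_n through a linear map γ a of k^n, and all γ a
are shown to be the identity. -/
theorem centralizer_standardTorus_self (hp : 3 ≤ p) (hpn : n = 1 → 5 ≤ p) {g : G k p n}
    (hg : g ∈ centralizer (standardTorus k p n n)) : g = 1 := by
  have hex : ∀ a h, ∃ c, g.1 (weightElt k n a h) = weightElt k n a c := fun a h =>
    exists_weightElt_of_weight a (centralizer_weight hg fun j => by
      rw [euler_eq_weightElt, weightElt_bracket, pair_zero, zero_smul, sub_zero, zero_add,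
        pair_single_right, one_mul, map_smul])
  choose c hc using hex
  let γ : (Fin n → ZMod p) → Module.End k (Fin n → k) := fun a =>
    { toFun := c a
      map_add' := fun h h' => weightElt_injective a (by rw [← hc, map_add, map_add, map_add, hc, hc])
      map_smul' := fun s h => weightElt_injective a (by
        rw [← hc, map_smul, map_smul, hc, RingHom.id_apply, map_smul]) }
  have hγ : ∀ a h, g.1 (weightElt k n a h) = weightElt k n a (γ a h) := hc
  have hfix : ∀ h, g.1 (torusElt n h) = torusElt n h := fun h =>
    (mem_centralizer _ _).1 hg _ (torusElt_mem n h)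
  have h0 : γ 0 = 1 := LinearMap.ext fun h => weightElt_injective (0 : Fin n → ZMod p) (by
    rw [← hγ, Module.End.one_apply, weightElt_zero, hfix])
  have hinj : ∀ a, Function.Injective (γ a) := fun a h h' e => weightElt_injective a
    (g.1.injective (by rw [hγ, hγ, e]))
  have hbr : ∀ a b h h', pair k b h • γ (a + b) h' - pair k a h' • γ (a + b) h =
      pair k b (γ a h) • γ b h' - pair k a (γ b h') • γ a h := fun a b h h' =>
    weightElt_injective (a + b) (by
      rw [← weightElt_bracket, ← hγ, ← hγ, ← G_bracket, weightElt_bracket, hγ, map_sub (γ _),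
        map_smul (γ _), map_smul (γ _)])
  -- Both p-th powers lie in the torus, where g is trivial, so h and γ a h have the same Frobenius
  -- twist.
  have hP : ∀ a h, pair k a h = 0 → pair k a (γ a h) = 0 → γ a h = h := by
    intro a h h1 h2
    have e := G_pMap g (weightElt k n a h)
    rw [hγ, pMap_weightElt h1, pMap_weightElt h2, hfix] at e
    have e' := torusElt_injective n e
    ext i
    exact (frobenius_inj k p (congrFun e' i)).symm
  have hone : ∀ a, γ a = 1 := by
    rcases lt_or_ge n 2 with hn | hn
    · interval_cases n
      · intro a; ext i; exact i.elim0
      · have hs : ∀ (a : ZMod p) (h : Fin 1 → k), pair k (fun _ : Fin 1 => a) h = h 0 * fp k p a :=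
          fun a h => by simp [pair_apply]
        have key := character_eq_one (c := fun a : ZMod p => γ (fun _ => a) 1 0) (hpn rfl)
          (by
            have : (fun _ => 0 : Fin 1 → ZMod p) = 0 := rfl
            simp only [this, h0]; simp)
          -- With h = h' = 1 the bracket relation reads (b - a) c(a+b) = (b - a) c(a) c(b), which
          -- says nothing when a = b.
          (by
            intro a b hab
            have e := congrFun (hbr (fun _ => a) (fun _ => b) 1 1) 0
            have hadd : (fun _ => a : Fin 1 → ZMod p) + (fun _ => b) = fun _ => a + b := rfl
            simp only [hs, hadd, Pi.sub_apply, Pi.smul_apply, smul_eq_mul, Pi.one_apply,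
              one_mul] at e
            have hne : fp k p b - fp k p a ≠ 0 := by
              rw [sub_ne_zero]
              exact fun h => hab ((fp k p).injective h).symm
            refine mul_left_cancel₀ hne ?_
            linear_combination e)
        intro a
        have ha : a = fun _ => a 0 := by ext i; rw [Subsingleton.elim i 0]
        refine LinearMap.ext fun h => ?_
        have hh : h = h 0 • (1 : Fin 1 → k) := by ext i; rw [Subsingleton.elim i 0]; simp
        ext i
        rw [Subsingleton.elim i 0, hh, map_smul, ha, Pi.smul_apply, key]
        simp
    · exact rigidity_of_two_le hp hn γ h0 hinj hbr hP
  refine eq_one_of_fixes_mono n fun a i => ?_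
  rw [weightElt_single, hγ, hone, Module.End.one_apply]

end FullRank

end Centralizer

/-! ### The case r < n: action on derivations constant in the nilpotent variables. -/

section PartialRank

variable {k : Type*} [Field k] {p n : ℕ} [hpp : Fact p.Prime] [CharP k p]

theorem zmod_two_ne_zero (hp : 3 ≤ p) : (2 : ZMod p) ≠ 0 := by
  intro h
  have : ((2 : ℕ) : ZMod p) = 0 := by exact_mod_cast h
  rw [ZMod.natCast_eq_zero_iff] at this
  exact absurd (Nat.le_of_dvd two_pos this) (by omega)

theorem bracket_smul_right (c : k) (D E : W k p n) : ⁅D, c • E⁆ = c • ⁅D, E⁆ := by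
  ext f
  simp only [bracket_apply, Derivation.smul_apply, Derivation.map_smul, smul_sub]

theorem bracket_sub_eq_zero {D E F : W k p n} (h : ⁅D, E⁆ = ⁅D, F⁆) : ⁅D, E - F⁆ = 0 := by
  ext f
  have hf := congrArg (fun D : W k p n => D f) h
  simp only [bracket_apply, Derivation.sub_apply, map_sub, Derivation.zero_apply] at hf ⊢
  linear_combination hf

theorem bracket_smul_left (c : k) (D E : W k p n) : ⁅c • D, E⁆ = c • ⁅D, E⁆ := by
  ext f
  simp only [bracket_apply, Derivation.smul_apply, Derivation.map_smul, smul_sub]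

theorem apply_ite_eq_zero (D : W k p n) (q : Prop) [Decidable q] : D (if q then 1 else 0) = 0 := by
  split_ifs <;> simp

theorem partialDeriv_apply_of_comm {r : ℕ} {E : W k p n} {j : Fin n}
    (h : ⁅partialDeriv k p n j, E⁆ = 0) (l : Fin n) :
    partialDeriv k p n j (E (z k p n r l)) = 0 := by
  have := congrArg (fun D : W k p n => D (z k p n r l)) h
  simpa only [bracket_apply, partialDeriv_z, apply_ite_eq_zero, sub_zero,
    Derivation.zero_apply] using this

/-- The derivation `z_j ^ 2 ∂_j`. -/
def quadElt (k : Type*) [Field k] (p n : ℕ) [CharP k p] (r : ℕ) (j : Fin n) : W k p n :=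
  (z k p n r j * z k p n r j) • partialDeriv k p n j

theorem quadElt_eq (hp : 3 ≤ p) (r : ℕ) (j : Fin n) : quadElt k p n r j =
    mono k r (Pi.single j 1 + Pi.single j 1 : Fin n → ZMod p) • partialDeriv k p n j := by
  rw [quadElt, ← z_mul_mono k, mono_single]
  right
  rw [Pi.single_eq_same]
  exact fun h => zmod_two_ne_zero hp (by linear_combination h)

theorem z_mul_z (hp : 3 ≤ p) (r : ℕ) (j l : Fin n) : z k p n r l * z k p n r j =
    mono k r (Pi.single j 1 + Pi.single l 1 : Fin n → ZMod p) := by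
  rw [← z_mul_mono k, mono_single]
  right
  by_cases h : l = j
  · subst h
    rw [Pi.single_eq_same]
    exact fun h => zmod_two_ne_zero hp (by linear_combination h)
  · rw [Pi.single_eq_of_ne h]
    exact fun h => one_ne_zero (α := ZMod p) (by linear_combination h)

theorem partialDeriv_bracket_quadElt (r : ℕ) (j : Fin n) :
    ⁅partialDeriv k p n j, quadElt k p n r j⁆ = (2 : k) • euler k p n r j := by
  refine derivation_ext_z r fun l => ?_
  simp only [bracket_apply, quadElt, Derivation.smul_apply, partialDeriv_z, apply_ite_eq_zero,
    euler, smul_eq_mul, mul_zero, sub_zero]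
  by_cases h : l = j
  · subst h
    simp only [if_true, mul_one, Derivation.leibniz, partialDeriv_z, smul_eq_mul, two_smul]
  · simp [h]

theorem partialDeriv_eq_mono (r : ℕ) (j : Fin n) : partialDeriv k p n j =
    mono k r (0 : Fin n → ZMod p) • partialDeriv k p n j := by
  ext f; rw [Derivation.smul_apply, mono_zero, smul_eq_mul, one_mul]

theorem pMap_partialDeriv (j : Fin n) : pMap (partialDeriv k p n j) = 0 := by
  refine derivation_ext_x fun i => ?_
  have : ∀ m : ℕ, ((partialDeriv k p n j : Module.End k (TruncPoly k p n)) ^ (m + 2))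
      (x k p n i) = 0 := fun m => by
    rw [pow_add, Module.End.mul_apply, pow_two, Module.End.mul_apply]
    simp only [Derivation.coeFn_coe, partialDeriv_x, apply_ite_eq_zero, map_zero]
  have h := this (p - 2)
  rwa [Nat.sub_add_cancel hpp.out.two_le] at h

theorem mono_neg_single {r : ℕ} (j : Fin n) :
    mono k r (-Pi.single j 1 : Fin n → ZMod p) = z k p n r j ^ (p - 1) := by
  have h1 : (-1 : ZMod p) = ((p - 1 : ℕ) : ZMod p) := by
    rw [Nat.cast_sub hpp.out.one_le]; simp
  have hv : ∀ l, ((-Pi.single j 1 : Fin n → ZMod p) l).val = if l = j then p - 1 else 0 := by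
    intro l
    by_cases h : l = j
    · subst h
      rw [Pi.neg_apply, Pi.single_eq_same, h1, if_pos rfl,
        ZMod.val_cast_of_lt (Nat.sub_lt hpp.out.pos one_pos)]
    · simp [h]
  simp only [mono, hv]
  simp

variable {r : ℕ} {g : G k p n} (hg : g ∈ centralizer (standardTorus k p n r))

-- By weight, D = g ∂_j sends z_j to a constant c_j and any other z_i to c_i z_i z_j^(p-1). The
-- bracket of D with the image of z_j^2 ∂_j is 2 z_j ∂_j, so c_j is nonzero. As ∂_j^p = 0, also D^p
-- = 0; but D^p(z_i) = c_i c_j^(p-1) (p-1)! z_i, so c_i = 0.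
include hg in
theorem centralizer_partialDeriv (hp : 3 ≤ p) {j : Fin n} (hj : r ≤ j) :
    ∃ c : kˣ, g.1 (partialDeriv k p n j) = (c : k) • partialDeriv k p n j := by
  obtain ⟨c, hc⟩ := centralizer_exists_form hg 0 j
  obtain ⟨b, hb⟩ := centralizer_exists_form hg (Pi.single j 1 + Pi.single j 1) j
  rw [← partialDeriv_eq_mono] at hc
  rw [← quadElt_eq hp] at hb
  set D := g.1 (partialDeriv k p n j) with hD
  set E := g.1 (quadElt k p n r j) with hE
  have hDj : D (z k p n r j) = algebraMap k _ (c j) := by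
    rw [hc, zero_sub, neg_add_cancel, mono_zero, Algebra.algebraMap_eq_smul_one]
  have hEj : E (z k p n r j) = b j • (z k p n r j * z k p n r j) := by
    rw [hb, z_mul_z hp, add_sub_cancel_right]
  have hbr : ⁅D, E⁆ = (2 : k) • euler k p n r j := by
    rw [hD, hE, ← G_bracket, partialDeriv_bracket_quadElt, map_smul,
      (mem_centralizer _ _).1 hg _ (euler_mem_standardTorus r j)]
  have hcj : c j ≠ 0 := by
    intro h0
    have := congrArg (fun D : W k p n => D (z k p n r j)) hbr
    simp only [bracket_apply, Derivation.smul_apply, hDj, hEj, h0, map_zero, sub_zero,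
      Derivation.map_smul, Derivation.leibniz, smul_zero, add_zero, euler_z, if_true] at this
    rw [eq_comm, smul_eq_zero_iff_right (two_ne_zero_of_three_le hp)] at this
    exact z_ne_zero r j this
  have hci : ∀ i, i ≠ j → c i = 0 := by
    intro i hij
    have hDi : D (z k p n r i) = c i • (z k p n r i * z k p n r j ^ (p - 1)) := by
      rw [hc, zero_sub, ← mono_neg_single, z_mul_mono]
      right
      simp [hij]
    have hstep : ∀ e : ℕ, 0 < e → D (z k p n r i * z k p n r j ^ e) =
        (e * c j : k) • (z k p n r i * z k p n r j ^ (e - 1)) := by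
      intro e he
      -- Nilpotency of z_j makes the contribution of D(z_i) vanish, so D only lowers the power of
      -- z_j from here on.
      have hz : z k p n r j ^ e * z k p n r j ^ (p - 1) = 0 := by
        rw [← pow_add, show e + (p - 1) = p + (e - 1) by omega, pow_add, z_pow_p_of_le hj, zero_mul]
      rw [Derivation.leibniz, Derivation.leibniz_pow, hDj, hDi]
      simp only [smul_eq_mul, mul_smul_comm]
      rw [mul_left_comm (z k p n r j ^ e), hz, mul_zero, smul_zero, add_zero, mul_smul, Nat.cast_smul_eq_nsmul]
      congr 1
      rw [mul_comm (z k p n r j ^ (e - 1)), ← mul_assoc, mul_comm (z k p n r i), mul_assoc]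
      exact (Algebra.smul_def (c j) (z k p n r i * z k p n r j ^ (e - 1))).symm
    have hpow : ∀ m : ℕ, m < p → ((D : Module.End k (TruncPoly k p n)) ^ (m + 1)) (z k p n r i) =
        (c i * c j ^ m * ((p - 1).descFactorial m : ℕ) : k) •
          (z k p n r i * z k p n r j ^ (p - 1 - m)) := by
      intro m
      induction m with
      | zero => intro _; simp [hDi]
      | succ m ih =>
        intro hm
        rw [pow_succ', Module.End.mul_apply, ih (by omega), map_smul, Derivation.coeFn_coe,
          hstep _ (by omega), smul_smul, Nat.descFactorial_succ,
          show p - 1 - m - 1 = p - 1 - (m + 1) by omega]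
        congr 1
        push_cast
        ring
    have h0 : pMap D = 0 := by rw [hD, ← G_pMap, pMap_partialDeriv, map_zero]
    have h1 := hpow (p - 1) (by omega)
    rw [Nat.sub_add_cancel hpp.out.one_le, ← pMap_apply, h0, Derivation.zero_apply, Nat.sub_self,
      pow_zero, mul_one, Nat.descFactorial_self, eq_comm, smul_eq_zero] at h1
    have hfac : (((p - 1).factorial : ℕ) : k) ≠ 0 := by
      rw [Ne, CharP.cast_eq_zero_iff k p, hpp.out.dvd_factorial]
      omega
    have h2 := h1.resolve_right (z_ne_zero r i)
    simpa [hcj, hfac] using h2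
  refine ⟨Units.mk0 _ hcj, derivation_ext_z r fun i => ?_⟩
  rw [Derivation.smul_apply, partialDeriv_z, Units.val_mk0]
  by_cases hij : i = j
  · subst hij
    rw [hDj, if_pos rfl, Algebra.algebraMap_eq_smul_one]
  · rw [hc, hci i hij, if_neg hij, zero_smul, smul_zero]

variable (hfix : ∀ j : Fin n, r ≤ j → g.1 (partialDeriv k p n j) = partialDeriv k p n j)

include hg hfix

/-- The weight leaves only terms z_l z_j ∂_l, and these are determined by their bracket with ∂_j,
which must be 2 z_j ∂_j. -/
theorem fixes_quadElt (hp : 3 ≤ p) {j : Fin n} (hj : r ≤ j) :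
    g.1 (quadElt k p n r j) = quadElt k p n r j := by
  obtain ⟨b, hb⟩ := centralizer_exists_form hg (Pi.single j 1 + Pi.single j 1) j
  rw [← quadElt_eq hp] at hb
  simp only [add_sub_cancel_right, ← z_mul_z hp] at hb
  have hbr : ⁅partialDeriv k p n j, g.1 (quadElt k p n r j)⁆ = (2 : k) • euler k p n r j := by
    rw [← hfix j hj, ← G_bracket, partialDeriv_bracket_quadElt, map_smul,
      (mem_centralizer _ _).1 hg _ (euler_mem_standardTorus r j)]
  refine derivation_ext_z r fun l => ?_
  have h1 := congrArg (fun D : W k p n => D (z k p n r l)) hbr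
  simp only [bracket_apply, partialDeriv_z, apply_ite_eq_zero, sub_zero, hb, Derivation.map_smul,
    Derivation.leibniz, Derivation.smul_apply, euler_z] at h1
  rw [hb, quadElt, Derivation.smul_apply, partialDeriv_z]
  by_cases h : l = j
  · subst h
    simp only [if_true, smul_eq_mul, mul_one, ← two_smul k (z k p n r l), smul_smul] at h1 ⊢
    have h2 := smul_left_injective k (z_ne_zero r l) h1
    have h3 : b l = 1 := mul_right_cancel₀ (two_ne_zero_of_three_le (k := k) hp) (by simpa using h2)
    rw [h3, one_smul]
  · simp only [h, if_false, if_true, smul_eq_mul, mul_one, mul_zero, add_zero, smul_zero] at h1 ⊢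
    rw [smul_eq_zero_iff_left (z_ne_zero r l)] at h1
    rw [h1, zero_smul]

omit hg hfix in
theorem partialDeriv_bracket_mono (r : ℕ) (i j : Fin n) (a : Fin n → ZMod p) :
    ⁅partialDeriv k p n j, mono k r a • partialDeriv k p n i⁆ =
      fp k p (a j) • (mono k r (a - Pi.single j 1) • partialDeriv k p n i) := by
  refine derivation_ext_z r fun l => ?_
  simp only [bracket_apply, Derivation.smul_apply, partialDeriv_z, apply_ite_eq_zero, smul_zero,
    sub_zero]
  by_cases h : l = i
  · simp [h, partialDeriv_mono]
  · simp [h]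

omit hg in
theorem comm_of_mono {j : Fin n} (hj : r ≤ j) {a : Fin n → ZMod p} (ha : a j = 0) (i : Fin n) :
    ⁅partialDeriv k p n j, g.1 (mono k r a • partialDeriv k p n i)⁆ = 0 := by
  rw [← hfix j hj, ← G_bracket, partialDeriv_bracket_mono, ha, map_zero, zero_smul, map_zero]

/-- A component along ∂_l with l ≠ j would have exponent -1 in z_j, hence would not commute with
∂_j. -/
theorem scales_mono_partialDeriv {j : Fin n} (hj : r ≤ j) {a : Fin n → ZMod p}
    (ha : ∀ l : Fin n, r ≤ l → a l = 0) : ∃ c : k,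
    g.1 (mono k r a • partialDeriv k p n j) = c • (mono k r a • partialDeriv k p n j) := by
  obtain ⟨c, hc⟩ := centralizer_exists_form hg a j
  refine ⟨c j, derivation_ext_z r fun l => ?_⟩
  rw [hc, Derivation.smul_apply, Derivation.smul_apply, partialDeriv_z]
  by_cases h : l = j
  · subst h; simp
  · have h1 := partialDeriv_apply_of_comm (r := r) (comm_of_mono hfix hj (ha j hj) j) l
    rw [hc, Derivation.map_smul, partialDeriv_mono, smul_smul, smul_eq_zero] at h1
    have h2 := h1.resolve_right (mono_ne_zero _ _)
    have h3 : c l = 0 := by simpa [ha j hj, h, Ne.symm h] using h2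
    rw [h3, if_neg h, smul_zero, smul_zero, zero_smul]

omit hg hfix in
theorem quadElt_bracket_mono {j : Fin n} {a : Fin n → ZMod p} (ha : a j = 0) :
    ⁅quadElt k p n r j, mono k r a • partialDeriv k p n j⁆ =
      (-2 : k) • ((mono k r a * z k p n r j) • partialDeriv k p n j) := by
  refine derivation_ext_z r fun l => ?_
  simp only [bracket_apply, quadElt, Derivation.smul_apply, partialDeriv_z]
  by_cases h : l = j
  · subst h
    simp only [if_true, smul_eq_mul, mul_one, partialDeriv_mono, ha, map_zero, zero_smul, mul_zero,
      Derivation.leibniz, partialDeriv_z, neg_smul, two_smul]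
    ring
  · simp [h]

omit hg hfix in
theorem mul_z_bracket_mono {j : Fin n} {a b : Fin n → ZMod p} (ha : ∀ l : Fin n, r ≤ l → a l = 0)
    (hj : r ≤ j) (hb : b j = 0) :
    ⁅(mono k r a * z k p n r j) • partialDeriv k p n j, mono k r b • partialDeriv k p n j⁆ =
      (-1 : k) • (mono k r (a + b) • partialDeriv k p n j) := by
  have hm : mono k r (a + b) = mono k r a * mono k r b := by
    rw [mono_mul_mono]
    intro i hi
    rw [ha i hi, ZMod.val_zero, zero_add]
    exact ZMod.val_lt _
  refine derivation_ext_z r fun l => ?_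
  simp only [bracket_apply, Derivation.smul_apply, partialDeriv_z]
  by_cases h : l = j
  · subst h
    simp only [if_true, smul_eq_mul, mul_one, partialDeriv_mono, ha l hj, hb, map_zero, zero_smul,
      mul_zero, Derivation.leibniz, partialDeriv_z, neg_smul, one_smul, hm]
    ring
  · simp [h]

omit hg hfix in
theorem smul_mono_partialDeriv_injective (r : ℕ) (a : Fin n → ZMod p) (j : Fin n) :
    Function.Injective fun c : k => c • (mono k r a • partialDeriv k p n j) := by
  intro c d h
  have := congrArg (fun D : W k p n => D (z k p n r j)) h
  simp only [Derivation.smul_apply, partialDeriv_z, if_true, smul_eq_mul, mul_one] at this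
  exact smul_left_injective k (mono_ne_zero r a) this

/-- The scalars c(a) by which z^a ∂_j is multiplied form a character. Bracketing with z_j^2 ∂_j
shows that z^a z_j ∂_j is scaled by c(a) too, and its bracket with z^b ∂_j is -z^(a+b) ∂_j. A
character of an elementary p-group in characteristic p is trivial. -/
theorem fixes_mono_partialDeriv (hp : 3 ≤ p) {j : Fin n} (hj : r ≤ j) {a : Fin n → ZMod p}
    (ha : ∀ l : Fin n, r ≤ l → a l = 0) :
    g.1 (mono k r a • partialDeriv k p n j) = mono k r a • partialDeriv k p n j ∧
    g.1 ((mono k r a * z k p n r j) • partialDeriv k p n j) =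
      (mono k r a * z k p n r j) • partialDeriv k p n j := by
  have h2 := two_ne_zero_of_three_le (k := k) hp
  have hex : ∀ a : Fin n → ZMod p, ∃ c : k, (∀ l : Fin n, r ≤ l → a l = 0) →
      g.1 (mono k r a • partialDeriv k p n j) = c • (mono k r a • partialDeriv k p n j) := by
    intro a
    by_cases ha : ∀ l : Fin n, r ≤ l → a l = 0
    · obtain ⟨c, hc⟩ := scales_mono_partialDeriv hg hfix hj ha
      exact ⟨c, fun _ => hc⟩
    · exact ⟨0, fun h => absurd h ha⟩
  choose c hc using hex
  have hz : ∀ a : Fin n → ZMod p, (∀ l : Fin n, r ≤ l → a l = 0) →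
      g.1 ((mono k r a * z k p n r j) • partialDeriv k p n j) =
      c a • ((mono k r a * z k p n r j) • partialDeriv k p n j) := by
    intro a ha
    have h := congrArg g.1 (quadElt_bracket_mono (k := k) (r := r) (ha j hj))
    rw [G_bracket, fixes_quadElt hg hfix hp hj, hc a ha, bracket_smul_right, quadElt_bracket_mono (ha j hj),
      map_smul, smul_comm] at h
    exact (smul_right_injective _ (neg_ne_zero.2 h2) h).symm
  have hmul : ∀ a b : Fin n → ZMod p, (∀ l : Fin n, r ≤ l → a l = 0) →
      (∀ l : Fin n, r ≤ l → b l = 0) → c (a + b) = c a * c b := by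
    intro a b ha hb
    have h := congrArg g.1 (mul_z_bracket_mono (k := k) ha hj (hb j hj))
    rw [G_bracket, hz a ha, hc b hb, bracket_smul_left, bracket_smul_right, mul_z_bracket_mono ha hj (hb j hj),
      map_smul, hc (a + b) fun l hl => by rw [Pi.add_apply, ha l hl, hb l hl, add_zero],
      smul_smul, smul_smul, smul_smul] at h
    have := smul_mono_partialDeriv_injective r (a + b) j h
    linear_combination this
  have h0 : c 0 = 1 := by
    have h := hc 0 fun _ _ => rfl
    rw [← partialDeriv_eq_mono, hfix j hj] at h
    have h' : (1 : k) • (mono k r (0 : Fin n → ZMod p) • partialDeriv k p n j) =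
        c 0 • (mono k r (0 : Fin n → ZMod p) • partialDeriv k p n j) := by
      rw [← partialDeriv_eq_mono, one_smul]; exact h
    exact (smul_mono_partialDeriv_injective r 0 j h').symm
  have hpow : ∀ m : ℕ, c (m • a) = c a ^ m := by
    intro m
    induction m with
    | zero => simpa using h0
    | succ m ih =>
      rw [succ_nsmul, hmul _ _ (fun l hl => by simp [ha l hl]) ha, ih, pow_succ]
  have h1 : c a = 1 := by
    have := hpow p
    rw [show p • a = 0 by ext l; simp, h0] at this
    refine frobenius_inj k p ?_
    rw [frobenius_def, frobenius_def, one_pow, this]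
  exact ⟨by rw [hc a ha, h1, one_smul], by rw [hz a ha, h1, one_smul]⟩

/-- The components along ∂_l with l < r are read off from brackets with the fixed elements z_l ∂_j.
Those with l ≥ r would have exponent 1 in z_l, contradicting commutation with ∂_l. -/
theorem fixes_mono_partialDeriv_of_lt (hp : 3 ≤ p) {j : Fin n} (hj : r ≤ j) {i : Fin n}
    (hi : (i : ℕ) < r) {a : Fin n → ZMod p} (ha : ∀ l : Fin n, r ≤ l → a l = 0) :
    g.1 (mono k r a • partialDeriv k p n i) = mono k r a • partialDeriv k p n i := by
  obtain ⟨c, hc⟩ := centralizer_exists_form hg a i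
  refine derivation_ext_z r fun l => ?_
  rcases lt_or_ge (l : ℕ) r with hl | hl
  · have hfl : g.1 (mono k r (Pi.single l 1 : Fin n → ZMod p) • partialDeriv k p n j) =
        mono k r (Pi.single l 1 : Fin n → ZMod p) • partialDeriv k p n j :=
      (fixes_mono_partialDeriv hg hfix hp hj fun m hm => by
        rw [Pi.single_eq_of_ne]; rintro rfl; omega).1
    have hij : j ≠ i := by rintro rfl; omega
    have hbr : ⁅mono k r a • partialDeriv k p n i,
        mono k r (Pi.single l 1 : Fin n → ZMod p) • partialDeriv k p n j⁆ =
        (if l = i then 1 else 0 : k) • (mono k r a • partialDeriv k p n j) := by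
      refine derivation_ext_z r fun m => ?_
      simp only [bracket_apply, Derivation.smul_apply, partialDeriv_z, mono_single]
      by_cases h1 : m = j
      · subst h1
        by_cases h2 : l = i <;> simp [h2, hij, partialDeriv_z]
      · by_cases h2 : m = i
        · subst h2; simp [h1, partialDeriv_mono, ha j hj]
        · simp [h1, h2]
    have h := congrArg (fun D : W k p n => D (z k p n r j)) (congrArg g.1 hbr)
    simp only [G_bracket, hfl, map_smul, (fixes_mono_partialDeriv hg hfix hp hj ha).1] at h
    simp only [bracket_apply, Derivation.smul_apply, partialDeriv_z, if_true, smul_eq_mul, mul_one,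
      partialDeriv_apply_of_comm (comm_of_mono hfix hj (ha j hj) i), mul_zero, sub_zero,
      mono_single] at h
    rw [h, Derivation.smul_apply, partialDeriv_z]
    split_ifs <;> simp
  · have h1 := partialDeriv_apply_of_comm (r := r) (comm_of_mono hfix hl (ha l hl) i) l
    have hil : l ≠ i := by rintro rfl; omega
    rw [hc, Derivation.map_smul, partialDeriv_mono, smul_smul, smul_eq_zero] at h1
    have h2 := h1.resolve_right (mono_ne_zero _ _)
    have h3 : c l = 0 := by simpa [ha l hl, hil] using h2
    rw [hc, h3, Derivation.smul_apply, partialDeriv_z, if_neg hil, smul_zero, zero_smul]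

end PartialRank

/-! ### Induction on the degree in the nilpotent variables. -/

section TorusAction

variable {k : Type*} [Field k] {p n : ℕ} [hpp : Fact p.Prime] [CharP k p]

/-- Exponent p - 1 in z_l is reached from p - 2 by bracketing with z_l^2 ∂_l, with the nonzero
factor p - 2 = -2. -/
theorem fixes_mono_of_eq_neg_one (hp : 3 ≤ p) {r : ℕ} {g : G k p n} {l i : Fin n} (hli : l ≠ i)
    {a : Fin n → ZMod p} (ha : a l = -1) (hQ : g.1 (quadElt k p n r l) = quadElt k p n r l)
    (h : g.1 (mono k r (a - Pi.single l 1) • partialDeriv k p n i) =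
      mono k r (a - Pi.single l 1) • partialDeriv k p n i) :
    g.1 (mono k r a • partialDeriv k p n i) = mono k r a • partialDeriv k p n i := by
  have h2 := two_ne_zero_of_three_le (k := k) hp
  have h2' := zmod_two_ne_zero hp
  have hzz : (z k p n r l * z k p n r l) * mono k r (a - Pi.single l 1 - Pi.single l 1) =
      mono k r a := by
    rw [mul_assoc, z_mul_mono, sub_add_cancel, z_mul_mono, sub_add_cancel]
    · right
      rw [Pi.sub_apply, ha, Pi.single_eq_same]
      exact fun h => one_ne_zero (α := ZMod p) (by linear_combination -h)
    · right
      rw [Pi.sub_apply, Pi.sub_apply, ha, Pi.single_eq_same]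
      exact fun h => h2' (by linear_combination -h)
  have hbr : ⁅quadElt k p n r l, mono k r (a - Pi.single l 1) • partialDeriv k p n i⁆ =
      (-2 : k) • (mono k r a • partialDeriv k p n i) := by
    refine derivation_ext_z r fun m => ?_
    simp only [bracket_apply, quadElt, Derivation.smul_apply, partialDeriv_z]
    by_cases h1 : m = i
    · subst h1
      simp only [Ne.symm hli, if_true, if_false, smul_eq_mul, mul_one, mul_zero, map_zero, sub_zero,
        partialDeriv_mono, mul_smul_comm, hzz, Pi.sub_apply, ha, Pi.single_eq_same, map_sub, map_neg,
        map_one]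
      congr 1
      ring
    · by_cases h3 : m = l
      · subst h3
        simp [hli, partialDeriv_z]
      · simp [h1, h3]
  have e := congrArg g.1 hbr
  rw [G_bracket, hQ, h, hbr, map_smul] at e
  exact (smul_right_injective _ (neg_ne_zero.2 h2) e).symm

/-- An element of the centralizer of a standard torus fixing the derivations `∂_j`, `r ≤ j`, is
trivial, provided there is at least one such `j`. -/
theorem eq_one_of_fixes_partialDeriv (hp : 3 ≤ p) {r : ℕ} (hr : r < n) {g : G k p n}
    (hg : g ∈ centralizer (standardTorus k p n r))
    (hfix : ∀ j : Fin n, r ≤ j → g.1 (partialDeriv k p n j) = partialDeriv k p n j) : g = 1 := by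
  have hbase : ∀ (a : Fin n → ZMod p) (i : Fin n), (∀ l : Fin n, r ≤ l → a l = 0) →
      g.1 (mono k r a • partialDeriv k p n i) = mono k r a • partialDeriv k p n i := by
    intro a i ha
    rcases lt_or_ge (i : ℕ) r with hi | hi
    · exact fixes_mono_partialDeriv_of_lt hg hfix hp (j := ⟨r, hr⟩) le_rfl hi ha
    · exact (fixes_mono_partialDeriv hg hfix hp hi ha).1
  let deg : (Fin n → ZMod p) → ℕ := fun a => ∑ j : Fin n, if r ≤ (j : ℕ) then (a j).val else 0
  have hdeg : ∀ (a : Fin n → ZMod p) (l : Fin n), r ≤ l → a l ≠ 0 →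
      deg (a - Pi.single l 1) < deg a := by
    intro a l hl hal
    refine Finset.sum_lt_sum (fun j _ => ?_) ⟨l, Finset.mem_univ l, ?_⟩
    · by_cases hjl : j = l
      · subst hjl
        rw [if_pos hl, if_pos hl, Pi.sub_apply, Pi.single_eq_same, val_sub_one hal]
        exact Nat.sub_le _ _
      · simp [hjl]
    · rw [if_pos hl, if_pos hl, Pi.sub_apply, Pi.single_eq_same, val_sub_one hal]
      have : (a l).val ≠ 0 := by rwa [Ne, ZMod.val_eq_zero]
      omega
  have main : ∀ N, ∀ a : Fin n → ZMod p, deg a = N → ∀ i,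
      g.1 (mono k r a • partialDeriv k p n i) = mono k r a • partialDeriv k p n i := by
    intro N
    induction N using Nat.strong_induction_on with
    | _ N ih =>
      intro a ha i
      by_cases hA : ∃ l : Fin n, r ≤ (l : ℕ) ∧ l ≠ i ∧ a l = -1
      · obtain ⟨l, hl, hli, hal⟩ := hA
        refine fixes_mono_of_eq_neg_one hp hli hal (fixes_quadElt hg hfix hp hl) ?_
        exact ih _ (ha ▸ hdeg a l hl (by rw [hal]; simp)) _ rfl i
      · push Not at hA
        by_contra hne
        obtain ⟨c, hc⟩ := centralizer_exists_form hg a i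
        obtain ⟨l, hl⟩ : ∃ l, g.1 (mono k r a • partialDeriv k p n i) (z k p n r l) ≠
            (mono k r a • partialDeriv k p n i) (z k p n r l) := by
          by_contra! h
          exact hne (derivation_ext_z r h)
        -- By induction g fixes the brackets with all ∂_j, so the defect of g at this element
        -- commutes with every ∂_j. A nonzero component of it therefore has no nilpotent variable in
        -- its monomial.
        have hcomm : ∀ j : Fin n, r ≤ (j : ℕ) → ⁅partialDeriv k p n j,
            g.1 (mono k r a • partialDeriv k p n i) - mono k r a • partialDeriv k p n i⁆ = 0 := by
          intro j hj
          refine bracket_sub_eq_zero ?_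
          conv_lhs => rw [← hfix j hj, ← G_bracket, partialDeriv_bracket_mono, map_smul]
          rw [partialDeriv_bracket_mono]
          by_cases haj : a j = 0
          · rw [haj, map_zero, zero_smul, zero_smul]
          · rw [ih _ (ha ▸ hdeg a j hj haj) _ rfl i]
        obtain ⟨d, hd⟩ : ∃ d : k, (g.1 (mono k r a • partialDeriv k p n i) -
            mono k r a • partialDeriv k p n i) (z k p n r l) =
            d • mono k r (a - Pi.single i 1 + Pi.single l 1) := by
          refine ⟨c l - if l = i then 1 else 0, ?_⟩
          rw [Derivation.sub_apply, hc, Derivation.smul_apply, partialDeriv_z, sub_smul]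
          by_cases h : l = i
          · subst h; simp
          · simp [h]
        have hd0 : d ≠ 0 := by
          rintro rfl
          rw [zero_smul, Derivation.sub_apply, sub_eq_zero] at hd
          exact hl hd
        have hzero : ∀ j : Fin n, r ≤ (j : ℕ) →
            (a - Pi.single i 1 + Pi.single l 1 : Fin n → ZMod p) j = 0 := by
          intro j hj
          have h1 := partialDeriv_apply_of_comm (r := r) (hcomm j hj) l
          rw [hd, Derivation.map_smul, partialDeriv_mono, smul_smul, smul_eq_zero] at h1
          have h2 := h1.resolve_right (mono_ne_zero _ _)
          rw [mul_eq_zero] at h2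
          exact (map_eq_zero _).1 (h2.resolve_left hd0)
        -- The vanishing of a - ε_i + ε_l on the nilpotent indices leaves the base case, the
        -- elements z^b z_i ∂_i handled by `fixes_mono_partialDeriv`, or a_l = -1 with l ≠ i, which
        -- is excluded by `hA`.
        by_cases hli : l = i
        · subst hli
          refine hne (hbase a l fun j hj => ?_)
          have := hzero j hj
          rwa [sub_add_cancel] at this
        · rcases lt_or_ge (l : ℕ) r with hlr | hlr
          · have hzero' : ∀ j : Fin n, r ≤ (j : ℕ) →
                (a - Pi.single i 1 : Fin n → ZMod p) j = 0 := by
              intro j hj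
              have := hzero j hj
              rwa [Pi.add_apply, Pi.single_eq_of_ne (by rintro rfl; omega), add_zero] at this
            rcases lt_or_ge (i : ℕ) r with hir | hir
            · refine hne (hbase a i fun j hj => ?_)
              have := hzero' j hj
              rwa [Pi.sub_apply, Pi.single_eq_of_ne (by rintro rfl; omega), sub_zero] at this
            · refine hne ?_
              have h1 := (fixes_mono_partialDeriv hg hfix hp hir hzero').2
              rwa [mul_comm, z_mul_mono, sub_add_cancel] at h1
              right
              rw [hzero' i hir]
              exact fun h => one_ne_zero (α := ZMod p) (by linear_combination h)
          · refine hA l hlr hli ?_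
            have := hzero l hlr
            rw [Pi.add_apply, Pi.sub_apply, Pi.single_eq_same, Pi.single_eq_of_ne hli,
              sub_zero] at this
            exact eq_neg_of_add_eq_zero_left this
  exact eq_one_of_fixes_mono r fun a i => main _ a rfl i

end TorusAction

/-! ### The diagonal group (k^*)^(n-r) is the whole centralizer of t_r. -/

section Diagonal

variable {k : Type*} [Field k] {p n : ℕ}

/-- The endomorphism `x_i ↦ s_i x_i` of `A(n)`. -/
def scaleHom (p : ℕ) (s : Fin n → k) : TruncPoly k p n →ₐ[k] TruncPoly k p n :=
  liftHom (fun i => s i • x k p n i) fun i => by rw [smul_pow, x_pow_p, smul_zero]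

theorem scaleHom_x (s : Fin n → k) (i : Fin n) :
    scaleHom p s (x k p n i) = s i • x k p n i := liftHom_x _ _ _

theorem scaleHom_scaleHom (s t : Fin n → k) (a : TruncPoly k p n) :
    scaleHom p s (scaleHom p t a) = scaleHom p (s * t) a := by
  change ((scaleHom p s).comp (scaleHom p t)) a = _
  congr 1
  refine algHom_ext_x fun i => ?_
  rw [AlgHom.comp_apply, scaleHom_x, map_smul, scaleHom_x, scaleHom_x, smul_smul, mul_comm,
    Pi.mul_apply]

theorem scaleHom_one (a : TruncPoly k p n) : scaleHom p (1 : Fin n → k) a = a := by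
  change _ = AlgHom.id k _ a
  congr 1
  exact algHom_ext_x fun i => by rw [scaleHom_x, Pi.one_apply, one_smul]; rfl

/-- The action of the torus `(k^*)^n` on `A(n)` by `x_i ↦ s_i x_i`. -/
def scale (k : Type*) [Field k] (p n : ℕ) :
    (Fin n → kˣ) →* (TruncPoly k p n ≃ₐ[k] TruncPoly k p n) where
  toFun s := AlgEquiv.ofAlgHom (scaleHom p fun i => (s i : k)) (scaleHom p fun i => ((s i)⁻¹ : kˣ))
    (AlgHom.ext fun a => by
      rw [AlgHom.comp_apply, scaleHom_scaleHom]
      exact (congrArg (fun t => scaleHom p t a) (by ext i; simp)).trans (scaleHom_one a))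
    (AlgHom.ext fun a => by
      rw [AlgHom.comp_apply, scaleHom_scaleHom]
      exact (congrArg (fun t => scaleHom p t a) (by ext i; simp)).trans (scaleHom_one a))
  map_one' := AlgEquiv.ext fun a => scaleHom_one a
  map_mul' s t := AlgEquiv.ext fun a => (scaleHom_scaleHom _ _ a).symm

theorem scale_x (s : Fin n → kˣ) (i : Fin n) :
    scale k p n s (x k p n i) = (s i : k) • x k p n i := scaleHom_x _ i

/-- The inclusion of `(k^*)^(n-r)` in `(k^*)^n` as the last `n - r` coordinates. -/
def extendUnits (k : Type*) [Field k] (n r : ℕ) : (Fin (n - r) → kˣ) →* (Fin n → kˣ) where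
  toFun s i := if h : r ≤ i then s ⟨i - r, by omega⟩ else 1
  map_one' := by ext i; split_ifs <;> simp
  map_mul' s t := by ext i; by_cases h : r ≤ (i : ℕ) <;> simp [h]

theorem extendUnits_of_lt {r : ℕ} (s : Fin (n - r) → kˣ) {i : Fin n} (h : (i : ℕ) < r) :
    extendUnits k n r s i = 1 := dif_neg (by omega)

theorem extendUnits_of_le {r : ℕ} (s : Fin (n - r) → kˣ) {i : Fin n} (h : r ≤ (i : ℕ)) :
    extendUnits k n r s i = s ⟨i - r, by omega⟩ := dif_pos h

theorem scale_z {r : ℕ} (s : Fin (n - r) → kˣ) (i : Fin n) :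
    scale k p n (extendUnits k n r s) (z k p n r i) =
      (extendUnits k n r s i : k) • z k p n r i := by
  unfold z
  split_ifs with h
  · rw [map_add, map_one, scale_x, extendUnits_of_lt s h, Units.val_one, one_smul, one_smul]
  · rw [scale_x]

variable [hpp : Fact p.Prime] [CharP k p]

/-- The action of the torus `(k^*)^(n-r)` on `W(n)`. -/
def diag (k : Type*) [Field k] (p n r : ℕ) [Fact p.Prime] [CharP k p] :
    (Fin (n - r) → kˣ) →* G k p n :=
  conjG.comp ((scale k p n).comp (extendUnits k n r))

theorem diag_mono {r : ℕ} (s : Fin (n - r) → kˣ) (a : Fin n → ZMod p) (i : Fin n) :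
    (diag k p n r s).1 (mono k r a • partialDeriv k p n i) =
      ((∏ l, (extendUnits k n r s l : k) ^ (a l).val) * (((extendUnits k n r s)⁻¹ i : kˣ) : k)) •
        (mono k r a • partialDeriv k p n i) := by
  refine derivation_ext_z r fun l => ?_
  change scale k p n (extendUnits k n r s) ((mono k r a • partialDeriv k p n i)
    ((scale k p n (extendUnits k n r s))⁻¹ (z k p n r l))) = _
  have hm : scale k p n (extendUnits k n r s) (mono k r a) =
      (∏ l, (extendUnits k n r s l : k) ^ (a l).val) • mono k r a := by
    rw [mono, map_prod, ← Finset.prod_smul]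
    exact Finset.prod_congr rfl fun l _ => by rw [map_pow, scale_z, smul_pow]
  rw [← map_inv, ← map_inv, scale_z, Derivation.map_smul, map_smul, Derivation.smul_apply,
    Derivation.smul_apply, Derivation.smul_apply, partialDeriv_z, map_inv]
  by_cases h : l = i
  · subst h
    rw [if_pos rfl, smul_eq_mul, mul_one, hm, smul_smul, mul_comm]
  · rw [if_neg h, smul_zero, map_zero, smul_zero, smul_zero]

theorem diag_partialDeriv {r : ℕ} (s : Fin (n - r) → kˣ) (i : Fin n) :
    (diag k p n r s).1 (partialDeriv k p n i) =
      (((extendUnits k n r s)⁻¹ i : kˣ) : k) • partialDeriv k p n i := by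
  have := diag_mono (k := k) (p := p) s 0 i
  rw [← partialDeriv_eq_mono] at this
  simpa using this

theorem diag_mem_centralizer {r : ℕ} (s : Fin (n - r) → kˣ) :
    diag k p n r s ∈ centralizer (standardTorus k p n r) := by
  rw [mem_centralizer]
  intro D hD
  obtain ⟨c, hc⟩ := mem_standardTorus.1 hD
  refine derivation_ext_z r fun l => ?_
  change scale k p n (extendUnits k n r s)
    (D ((scale k p n (extendUnits k n r s))⁻¹ (z k p n r l))) = _
  rw [← map_inv, ← map_inv, scale_z, Derivation.map_smul, map_smul, hc, map_smul, scale_z, map_inv,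
    smul_comm (c l), smul_smul]
  simp

theorem diag_injective (r : ℕ) : Function.Injective (diag k p n r) := by
  rw [injective_iff_map_eq_one]
  intro s hs
  ext i
  have h := diag_partialDeriv (p := p) s ⟨r + i, by omega⟩
  have h1 := congrArg (fun D : W k p n => eval0 k p n (D (x k p n ⟨r + i, by omega⟩))) h
  have h2 : extendUnits k n r s ⟨r + i, by omega⟩ = s i := by
    rw [extendUnits_of_le s (Nat.le_add_right r i)]
    congr 1
    exact Fin.ext (by simp)
  simp only [hs, Derivation.smul_apply, map_smul, Pi.inv_apply, h2] at h1
  change eval0 k p n (partialDeriv k p n _ _) = _ at h1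
  rw [partialDeriv_x, if_pos rfl, map_one, smul_eq_mul, mul_one, eq_comm, Units.val_eq_one,
    inv_eq_one] at h1
  rw [h1]; rfl

/-- The centralizer of the standard torus `t_r` is the torus `(k^*)^(n-r)`. -/
theorem range_diag (hp : 3 ≤ p) (hpn : n = 1 → 5 ≤ p) {r : ℕ} (hr : r ≤ n) :
    (diag k p n r).range = centralizer (standardTorus k p n r) := by
  refine le_antisymm ?_ fun g hg => ?_
  · rintro _ ⟨s, rfl⟩
    exact diag_mem_centralizer s
  · rcases hr.lt_or_eq with hr | rfl
    · have hex : ∀ i : Fin (n - r), ∃ c : kˣ, g.1 (partialDeriv k p n ⟨r + i, by omega⟩) =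
          (c : k) • partialDeriv k p n ⟨r + i, by omega⟩ := fun i =>
        centralizer_partialDeriv hg hp (Nat.le_add_right r i)
      choose c hc using hex
      refine ⟨c⁻¹, ?_⟩
      -- The diagonal element c multiplies ∂_j by the inverse of c_j, cancelling the action of g.
      have h1 : (diag k p n r c) * g = 1 := by
        refine eq_one_of_fixes_partialDeriv hp hr (mul_mem (diag_mem_centralizer c) hg)
          fun j hj => ?_
        have h := hc ⟨j - r, by omega⟩
        have hj' : (⟨r + (j - r), by omega⟩ : Fin n) = j := Fin.ext (by simp; omega)
        rw [hj'] at h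
        rw [G_mul_apply, h, map_smul, diag_partialDeriv, smul_smul, Pi.inv_apply,
          extendUnits_of_le c hj, Units.mul_inv, one_smul]
      rw [map_inv]
      exact inv_eq_of_mul_eq_one_right h1
    · rw [centralizer_standardTorus_self hp hpn hg]
      exact one_mem _

end Diagonal

/-! ### Laurent polynomials and connectedness of (k^*)^m. -/

section Laurent

variable {k : Type*} [Field k] {m : ℕ}

theorem torusRegular_comp_inv {f : (Fin m → kˣ) → k} (hf : f ∈ torusRegularFunctions k m) :
    (fun s => f s⁻¹) ∈ torusRegularFunctions k m := by
  induction hf using Algebra.adjoin_induction with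
  | mem f hf =>
    obtain ⟨i, rfl | rfl⟩ := hf
    · exact Algebra.subset_adjoin ⟨i, Or.inr (by ext s; simp)⟩
    · exact Algebra.subset_adjoin ⟨i, Or.inl (by ext s; simp)⟩
  | algebraMap c => exact Subalgebra.algebraMap_mem _ c
  | add f g _ _ hf hg => exact add_mem hf hg
  | mul f g _ _ hf hg => exact mul_mem hf hg

theorem torusRegular_exists_polynomial {f : (Fin m → kˣ) → k}
    (hf : f ∈ torusRegularFunctions k m) : ∃ (P : MvPolynomial (Fin m) k) (N : ℕ),
      ∀ s, f s * (∏ i, (s i : k)) ^ N = MvPolynomial.eval (fun i => (s i : k)) P := by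
  induction hf using Algebra.adjoin_induction with
  | mem f hf =>
    obtain ⟨i, rfl | rfl⟩ := hf
    · exact ⟨MvPolynomial.X i, 0, fun s => by simp⟩
    · refine ⟨∏ j ∈ Finset.univ.erase i, MvPolynomial.X j, 1, fun s => ?_⟩
      rw [pow_one, ← Finset.mul_prod_erase _ _ (Finset.mem_univ i), map_prod]
      simp
  | algebraMap c => exact ⟨MvPolynomial.C c, 0, fun s => by simp⟩
  | add f g _ _ hf hg =>
    obtain ⟨P, N, hP⟩ := hf
    obtain ⟨Q, M, hQ⟩ := hg
    refine ⟨P * (∏ i, MvPolynomial.X i) ^ M + Q * (∏ i, MvPolynomial.X i) ^ N, N + M,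
      fun s => ?_⟩
    simp only [map_add, map_mul, map_pow, map_prod, MvPolynomial.eval_X, ← hP, ← hQ, Pi.add_apply]
    ring
  | mul f g _ _ hf hg =>
    obtain ⟨P, N, hP⟩ := hf
    obtain ⟨Q, M, hQ⟩ := hg
    refine ⟨P * Q, N + M, fun s => ?_⟩
    simp only [map_mul, ← hP, ← hQ, Pi.mul_apply]
    ring

/-- This is irreducibility of the torus: after denominators are cleared, a product of nonzero
polynomials is nonzero at some point. The extra factor ∏ X_i forces that point to have invertible
coordinates. -/
theorem torusRegular_exists_ne_zero [Infinite k] {f g : (Fin m → kˣ) → k}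
    (hf : f ∈ torusRegularFunctions k m) (hg : g ∈ torusRegularFunctions k m)
    (hf0 : ∃ s, f s ≠ 0) (hg0 : ∃ s, g s ≠ 0) : ∃ s, f s ≠ 0 ∧ g s ≠ 0 := by
  obtain ⟨P, N, hP⟩ := torusRegular_exists_polynomial hf
  obtain ⟨Q, M, hQ⟩ := torusRegular_exists_polynomial hg
  have hne : ∀ (s : Fin m → kˣ) (N : ℕ), (∏ i, (s i : k)) ^ N ≠ 0 := fun s N =>
    pow_ne_zero _ (Finset.prod_ne_zero_iff.2 fun i _ => (s i).ne_zero)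
  have hP0 : P ≠ 0 := by
    rintro rfl
    obtain ⟨s, hs⟩ := hf0
    simpa [hs] using (mul_ne_zero hs (hne s N)) (by rw [hP, map_zero])
  have hQ0 : Q ≠ 0 := by
    rintro rfl
    obtain ⟨s, hs⟩ := hg0
    simpa [hs] using (mul_ne_zero hs (hne s M)) (by rw [hQ, map_zero])
  have hX0 : (∏ i : Fin m, MvPolynomial.X i : MvPolynomial (Fin m) k) ≠ 0 :=
    Finset.prod_ne_zero_iff.2 fun i _ => MvPolynomial.X_ne_zero i
  have hne0 := mul_ne_zero (mul_ne_zero hP0 hQ0) hX0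
  obtain ⟨v, hv⟩ : ∃ v : Fin m → k,
      MvPolynomial.eval v (P * Q * ∏ i, MvPolynomial.X i) ≠ 0 := by
    by_contra! h
    exact hne0 (MvPolynomial.funext fun v => by rw [h, map_zero])
  simp only [map_mul, map_prod, MvPolynomial.eval_X, mul_ne_zero_iff] at hv
  have hvi : ∀ i, v i ≠ 0 := fun i => Finset.prod_ne_zero_iff.1 hv.2 i (Finset.mem_univ i)
  refine ⟨fun i => Units.mk0 (v i) (hvi i), fun h => hv.1.1 ?_, fun h => hv.1.2 ?_⟩
  · have := hP fun i => Units.mk0 (v i) (hvi i)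
    rw [h, zero_mul] at this
    exact this.symm
  · have := hQ fun i => Units.mk0 (v i) (hvi i)
    rw [h, zero_mul] at this
    exact this.symm

theorem zariskiTopology_exists_basic {Γ : Type*} (R : Subalgebra k (Γ → k)) {U : Set Γ}
    (hU : @IsOpen _ (zariskiTopology R) U) {a : Γ} (ha : a ∈ U) :
    ∃ f ∈ R, f a ≠ 0 ∧ {b | f b ≠ 0} ⊆ U := by
  let _ := zariskiTopology R
  have hbasis : TopologicalSpace.IsTopologicalBasis {U : Set Γ | ∃ f ∈ R, U = {g | f g ≠ 0}} := by
    refine ⟨?_, ?_, rfl⟩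
    · rintro _ ⟨f, hf, rfl⟩ _ ⟨g, hg, rfl⟩ b hb
      exact ⟨_, ⟨f * g, mul_mem hf hg, rfl⟩, mul_ne_zero hb.1 hb.2,
        fun c hc => ⟨left_ne_zero_of_mul hc, right_ne_zero_of_mul hc⟩⟩
    · refine Set.eq_univ_of_forall fun b => ⟨_, ⟨1, one_mem R, rfl⟩, ?_⟩
      simp
  obtain ⟨_, ⟨f, hf, rfl⟩, h1, h2⟩ := hbasis.exists_subset_of_mem_open ha hU
  exact ⟨f, hf, h1, h2⟩

/-- The torus `(k^*)^m` is connected in the Zariski topology. -/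
theorem preconnectedSpace_torus (k : Type*) [Field k] [Infinite k] (m : ℕ) :
    @PreconnectedSpace (Fin m → kˣ) (zariskiTopology (torusRegularFunctions k m)) := by
  let _ := zariskiTopology (torusRegularFunctions k m)
  refine ⟨?_⟩
  rintro U V hU hV - ⟨a, -, ha⟩ ⟨b, -, hb⟩
  obtain ⟨f, hf, hfa, hfU⟩ := zariskiTopology_exists_basic _ hU ha
  obtain ⟨g, hg, hgb, hgV⟩ := zariskiTopology_exists_basic _ hV hb
  obtain ⟨s, hfs, hgs⟩ := torusRegular_exists_ne_zero hf hg ⟨a, hfa⟩ ⟨b, hgb⟩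
  exact ⟨s, trivial, hfU hfs, hgV hgs⟩

end Laurent

/-! ### Algebraic group structure of the centralizer, and the identity component. -/

section Regular

variable {k : Type*} [Field k] {p n : ℕ} [hpp : Fact p.Prime] [CharP k p]

theorem extendUnits_regular (r : ℕ) (i : Fin n) :
    (fun s => (extendUnits k n r s i : k)) ∈ torusRegularFunctions k (n - r) := by
  by_cases h : r ≤ (i : ℕ)
  · simp only [extendUnits_of_le _ h]
    exact Algebra.subset_adjoin ⟨_, Or.inl rfl⟩
  · simp only [extendUnits_of_lt _ (not_le.1 h)]
    exact one_mem (torusRegularFunctions k (n - r))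

theorem diag_coefficient_regular (r : ℕ) (ξ : Module.Dual k (W k p n)) (D : W k p n) :
    (fun s => ξ ((diag k p n r s).1 D)) ∈ torusRegularFunctions k (n - r) := by
  have hmono : ∀ (a : Fin n → ZMod p) (i : Fin n),
      (fun s => ξ ((diag k p n r s).1 (mono k r a • partialDeriv k p n i))) ∈
        torusRegularFunctions k (n - r) := by
    intro a i
    have h1 : (fun s => (((extendUnits k n r s)⁻¹ i : kˣ) : k)) ∈ torusRegularFunctions k (n - r) := by
      have := torusRegular_comp_inv (extendUnits_regular (k := k) r i)
      simpa only [map_inv] using this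
    have h2 : (∏ l, (fun s => (extendUnits k n r s l : k)) ^ (a l).val) ∈
        torusRegularFunctions k (n - r) :=
      prod_mem fun l _ => pow_mem (extendUnits_regular r l) _
    have h3 := Subalgebra.smul_mem _ (mul_mem h2 h1) (ξ (mono k r a • partialDeriv k p n i))
    convert h3 using 1
    ext s
    rw [diag_mono, map_smul, Pi.smul_apply, Pi.mul_apply, Finset.prod_apply, smul_eq_mul,
      smul_eq_mul, mul_comm]
    rfl
  have hall : ∀ (f : TruncPoly k p n) (i : Fin n),
      (fun s => ξ ((diag k p n r s).1 (f • partialDeriv k p n i))) ∈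
        torusRegularFunctions k (n - r) := by
    intro f i
    have hf : f ∈ Submodule.span k (Set.range (mono k r)) := by rw [span_mono]; trivial
    induction hf using Submodule.span_induction with
    | mem f hf => obtain ⟨a, rfl⟩ := hf; exact hmono a i
    | zero =>
      have : (0 : TruncPoly k p n) • partialDeriv k p n i = 0 := by
        ext f; rw [Derivation.smul_apply, smul_eq_mul, zero_mul, Derivation.zero_apply]
      simp only [this, map_zero]
      exact zero_mem (torusRegularFunctions k (n - r))
    | add a b _ _ ha hb => simp only [add_smul, map_add]; exact add_mem ha hb
    | smul c a _ ha =>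
      simp only [smul_assoc, map_smul]
      exact Subalgebra.smul_mem _ ha c
  rw [eq_sum_smul_partialDeriv r D]
  simp only [map_sum]
  have := sum_mem fun i (_ : i ∈ Finset.univ) => hall (D (z k p n r i)) i
  convert this using 1
  ext s
  rw [Finset.sum_apply]

/-- Regular functions on a group of automorphisms of `W(n)` pull back to regular functions under a
conjugate of the action of `(k^*)^(n-r)` on `W(n)`. -/
theorem regularFunctions_pullback {Γ : Type*} [Group Γ] (ρ : Γ →* (W k p n ≃ₗ[k] W k p n)) {r : ℕ}
    (g : G k p n) (ψ : (Fin (n - r) → kˣ) →* Γ)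
    (hψ : ∀ s, ρ (ψ s) = (g * diag k p n r s * g⁻¹).1) {F : Γ → k} (hF : F ∈ regularFunctions ρ) :
    F ∘ ψ ∈ torusRegularFunctions k (n - r) := by
  induction hF using Algebra.adjoin_induction with
  | mem F hF =>
    obtain ⟨ξ, v, rfl | rfl⟩ := hF
    · have := diag_coefficient_regular r (ξ ∘ₗ (g.1 : W k p n →ₗ[k] W k p n)) (g⁻¹.1 v)
      convert this using 1
      ext s
      rw [Function.comp_apply, hψ]
      rfl
    · have := torusRegular_comp_inv
        (diag_coefficient_regular r (ξ ∘ₗ (g.1 : W k p n →ₗ[k] W k p n)) (g⁻¹.1 v))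
      convert this using 1
      ext s
      rw [Function.comp_apply, ← map_inv, hψ]
      rfl
  | algebraMap c => exact Subalgebra.algebraMap_mem _ c
  | add f g _ _ hf hg => exact add_mem hf hg
  | mul f g _ _ hf hg => exact mul_mem hf hg

/-- The conjugate by `g` of the action of `(k^*)^(n-r)` on `W(n)`. -/
def conjDiag (r : ℕ) (g : G k p n) : (Fin (n - r) → kˣ) →* G k p n :=
  (MulAut.conj g).toMonoidHom.comp (diag k p n r)

theorem conjDiag_apply (r : ℕ) (g : G k p n) (s : Fin (n - r) → kˣ) :
    conjDiag r g s = g * diag k p n r s * g⁻¹ := rfl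

theorem conjDiag_injective (r : ℕ) (g : G k p n) : Function.Injective (conjDiag r g) :=
  (MulAut.conj g).injective.comp (diag_injective r)

theorem mem_centralizer_smul (g h : G k p n) (t : Submodule k (W k p n)) :
    h ∈ centralizer (g • t) ↔ g⁻¹ * h * g ∈ centralizer t := by
  rw [mem_centralizer, mem_centralizer]
  constructor
  · intro H D hD
    rw [G_mul_apply, G_mul_apply, H _ ((mem_smul_iff _ _ _).2 ⟨D, hD, rfl⟩), G_inv_apply_self]
  · intro H D hD
    obtain ⟨E, hE, rfl⟩ := (mem_smul_iff _ _ _).1 hD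
    have := H E hE
    rw [G_mul_apply, G_mul_apply] at this
    rw [← G_apply_inv_self g (h.1 (g.1 E)), this]

theorem range_conjDiag (hp : 3 ≤ p) (hpn : n = 1 → 5 ≤ p) {r : ℕ} (hr : r ≤ n) (g : G k p n) :
    (conjDiag r g).range = centralizer (g • standardTorus k p n r) := by
  ext h
  rw [mem_centralizer_smul, ← range_diag hp hpn hr, MonoidHom.mem_range, MonoidHom.mem_range]
  refine exists_congr fun s => ?_
  rw [conjDiag_apply]
  constructor
  · rintro rfl; group
  · intro e; rw [e]; group

/-- The coefficient of `∂_j` at the origin in `g D`, as a linear form in `D`. -/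
def coefficientAt (g : G k p n) (j : Fin n) : Module.Dual k (W k p n) where
  toFun D := eval0 k p n (g.1 D (x k p n j))
  map_add' D E := by rw [map_add, Derivation.add_apply, map_add]
  map_smul' c D := by rw [map_smul, Derivation.smul_apply, map_smul, RingHom.id_apply]

theorem coefficientAt_apply (g : G k p n) (j : Fin n) (D : W k p n) :
    coefficientAt g j D = eval0 k p n (g.1 D (x k p n j)) := rfl

/-- This exhibits the inverse coordinates of the torus as matrix coefficients of the conjugated
action, so that the inverse of the parametrisation is regular. -/
theorem coefficientAt_conjDiag {r : ℕ} (g : G k p n) (j : Fin n) (s : Fin (n - r) → kˣ) :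
    coefficientAt g⁻¹ j ((g * diag k p n r s * g⁻¹).1 (g.1 (partialDeriv k p n j))) =
      ((extendUnits k n r s j)⁻¹ : k) := by
  rw [coefficientAt_apply, G_mul_apply, G_mul_apply, G_inv_apply_self, G_inv_apply_self,
    diag_partialDeriv, Derivation.smul_apply, partialDeriv_x, if_pos rfl, map_smul, map_one,
    smul_eq_mul, mul_one, Pi.inv_apply, Units.val_inv_eq_inv_val]

section

variable {H : Subgroup (G k p n)} {r : ℕ} {g : G k p n} {e : (Fin (n - r) → kˣ) ≃* H}
  (he : ∀ s, (e s : G k p n) = g * diag k p n r s * g⁻¹)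

include he

theorem torusRegular_of_comp_symm {f : (Fin (n - r) → kˣ) → k}
    (hf : f ∘ e.symm ∈ regularFunctionsOf H) : f ∈ torusRegularFunctions k (n - r) := by
  have := regularFunctions_pullback ((G k p n).subtype.comp H.subtype) g e.toMonoidHom
    (fun s => congrArg Subtype.val (he s)) hf
  convert this using 1
  ext s
  exact congrArg f (e.symm_apply_apply s).symm

theorem coefficientAt_symm (i : Fin (n - r)) : ∃ j : Fin n, ∀ h : H,
    coefficientAt g⁻¹ j ((h : G k p n).1 (g.1 (partialDeriv k p n j))) =
      ((e.symm h i)⁻¹ : k) := by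
  refine ⟨⟨r + i, by omega⟩, fun h => ?_⟩
  have h0 := he (e.symm h)
  rw [e.apply_symm_apply] at h0
  rw [h0, coefficientAt_conjDiag, extendUnits_of_le _ (Nat.le_add_right r i)]
  simp only [Nat.add_sub_cancel_left]

theorem comp_symm_regular {f : (Fin (n - r) → kˣ) → k}
    (hf : f ∈ torusRegularFunctions k (n - r)) : f ∘ e.symm ∈ regularFunctionsOf H := by
  induction hf using Algebra.adjoin_induction with
  | mem f hf =>
    obtain ⟨i, hi⟩ := hf
    obtain ⟨j, hj⟩ := coefficientAt_symm he i
    refine Algebra.subset_adjoin ⟨coefficientAt g⁻¹ j, g.1 (partialDeriv k p n j), ?_⟩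
    rcases hi with rfl | rfl
    -- The coordinate s_i itself is a matrix coefficient of the inverse of h.
    · refine Or.inr (funext fun h => ?_)
      refine Eq.trans ?_ (hj h⁻¹).symm
      rw [map_inv, Pi.inv_apply, Units.val_inv_eq_inv_val, inv_inv]
      rfl
    · exact Or.inl (funext fun h => (hj h).symm)
  | algebraMap c => exact Subalgebra.algebraMap_mem (regularFunctionsOf H) c
  | add f g _ _ hf hg => exact add_mem (S := Subalgebra k (H → k)) hf hg
  | mul f g _ _ hf hg => exact mul_mem (S := Subalgebra k (H → k)) hf hg

end

theorem isIsomorphicToTorus_centralizer (hp : 3 ≤ p) (hpn : n = 1 → 5 ≤ p) {r : ℕ} (hr : r ≤ n)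
    (g : G k p n) : IsIsomorphicToTorus (centralizer (g • standardTorus k p n r)) (n - r) := by
  obtain ⟨e, he⟩ : ∃ e : (Fin (n - r) → kˣ) ≃* centralizer (g • standardTorus k p n r),
      ∀ s, ((e s : G k p n)) = g * diag k p n r s * g⁻¹ :=
    ⟨(MonoidHom.ofInjective (conjDiag_injective r g)).trans
      (MulEquiv.subgroupCongr (range_conjDiag hp hpn hr g)), fun s => rfl⟩
  exact ⟨e.symm, fun f => ⟨torusRegular_of_comp_symm he, comp_symm_regular he⟩⟩

/-- A conjugate of a standard torus is spanned by its toral elements. -/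
theorem span_toral_smul (r : ℕ) (g : G k p n) : g • standardTorus k p n r ≤
    Submodule.span k {D | D ∈ g • standardTorus k p n r ∧ pMap D = D} := by
  intro D hD
  obtain ⟨E, hE, rfl⟩ := (mem_smul_iff _ _ _).1 hD
  clear hD
  induction hE using Submodule.span_induction with
  | mem E hE =>
    obtain ⟨i, rfl⟩ := hE
    refine Submodule.subset_span ⟨(mem_smul_iff _ _ _).2 ⟨_, euler_mem_standardTorus r i, rfl⟩, ?_⟩
    rw [← G_pMap]
    exact congrArg g.1 (pMap_euler r i)
  | zero => rw [map_zero]; exact zero_mem _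
  | add D E _ _ hD hE => rw [map_add]; exact add_mem hD hE
  | smul c D _ hD => rw [map_smul]; exact Submodule.smul_mem _ _ hD

theorem finite_toral_smul (r : ℕ) (g : G k p n) :
    {D | D ∈ g • standardTorus k p n r ∧ pMap D = D}.Finite := by
  refine ((finite_toral_standardTorus r).image g.1).subset ?_
  rintro D ⟨hD, hD'⟩
  obtain ⟨E, hE, rfl⟩ := (mem_smul_iff _ _ _).1 hD
  rw [← G_pMap] at hD'
  exact ⟨E, ⟨hE, g.1.injective hD'⟩, rfl⟩

theorem exists_dual_apply_ne {V : Type*} [AddCommGroup V] [Module k V] {v w : V} (h : v ≠ w) :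
    ∃ ξ : Module.Dual k V, ξ v - ξ w ≠ 0 := by
  by_contra! h0
  refine h (sub_eq_zero.1 ((Module.forall_dual_apply_eq_zero_iff k _).1 fun ξ => ?_))
  rw [map_sub, h0]

/-- Vectors are separated by linear forms, so the condition is a union of non-vanishing loci of
matrix coefficients shifted by constants. -/
theorem isOpen_apply_ne (D E : W k p n) :
    @IsOpen _ (zariskiTopology (regularFunctions (G k p n).subtype)) {g | g.1 D ≠ E} := by
  let _ := zariskiTopology (regularFunctions (G k p n).subtype)
  have : {g : G k p n | g.1 D ≠ E} =
      ⋃ ξ : Module.Dual k (W k p n), {g : G k p n | ξ (g.1 D) - ξ E ≠ 0} := by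
    ext g
    rw [Set.mem_iUnion]
    exact ⟨fun h => exists_dual_apply_ne h, fun ⟨ξ, h⟩ h0 => h (by rw [h0, sub_self])⟩
  rw [this]
  refine isOpen_iUnion fun ξ => TopologicalSpace.isOpen_generateFrom_of_mem
    ⟨(fun g => ξ (g.1 D)) - algebraMap k _ (ξ E), sub_mem ?_ (Subalgebra.algebraMap_mem _ _), rfl⟩
  exact Algebra.subset_adjoin ⟨ξ, D, Or.inl rfl⟩

/-- The centralizer is the continuous image of a connected torus. In the other direction, the orbit
of a toral element of t under the normalizer is finite, so a connected set containing 1 fixes it;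
the toral elements span t. -/
theorem identityComponent_normalizer [Infinite k] (hp : 3 ≤ p) (hpn : n = 1 → 5 ≤ p) {r : ℕ}
    (hr : r ≤ n) (g : G k p n) :
    (centralizer (g • standardTorus k p n r) : Set (G k p n)) =
      identityComponent (normalizer (g • standardTorus k p n r)) := by
  let _ := zariskiTopology (regularFunctions (G k p n).subtype)
  set t := g • standardTorus k p n r with ht
  refine Set.Subset.antisymm ?_ ?_
  · refine IsPreconnected.subset_connectedComponentIn ?_ (one_mem (centralizer t))
      (centralizer_le_normalizer t)
    rw [ht, ← range_conjDiag hp hpn hr g, MonoidHom.coe_range]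
    let _ := zariskiTopology (torusRegularFunctions k (n - r))
    have := preconnectedSpace_torus k (n - r)
    refine isPreconnected_range (continuous_generateFrom_iff.2 ?_)
    rintro _ ⟨F, hF, rfl⟩
    exact TopologicalSpace.isOpen_generateFrom_of_mem
      ⟨F ∘ conjDiag r g, regularFunctions_pullback _ g _ (fun s => rfl) hF, rfl⟩
  · intro h hh
    rw [SetLike.mem_coe, mem_centralizer]
    have hN : ∀ h ∈ connectedComponentIn (normalizer t : Set (G k p n)) 1, h ∈ normalizer t :=
      fun h hh => connectedComponentIn_subset _ _ hh
    have hK := isPreconnected_connectedComponentIn (x := (1 : G k p n))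
      (F := (normalizer t : Set (G k p n)))
    have hfix : ∀ D, D ∈ t → pMap D = D → h.1 D = D := by
      intro D hD hD'
      by_contra hne
      have hfin := (finite_toral_smul r g).subset
        (Set.sdiff_subset : {D | D ∈ t ∧ pMap D = D} \ {D} ⊆ _)
      -- The open conditions "g moves D" and "g sends D to no other toral element of t" cover the
      -- component and each holds somewhere on it. A common point would send D to a toral element of
      -- t that is neither D nor any other.
      have hV : IsOpen (⋂ E ∈ {D | D ∈ t ∧ pMap D = D} \ {D}, {g : G k p n | g.1 D ≠ E}) :=
        hfin.isOpen_biInter fun E _ => isOpen_apply_ne D E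
      have hcover : connectedComponentIn (normalizer t : Set (G k p n)) 1 ⊆ {g | g.1 D ≠ D} ∪
          ⋂ E ∈ {D | D ∈ t ∧ pMap D = D} \ {D}, {g : G k p n | g.1 D ≠ E} := by
        intro g' _
        by_cases hg : g'.1 D = D
        · right
          rw [Set.mem_iInter₂]
          intro E hE
          rw [Set.mem_ofPred_eq, hg]
          exact fun h => hE.2 h.symm
        · exact Or.inl hg
      obtain ⟨g', hg', hU, hV'⟩ := hK _ _ (isOpen_apply_ne D D) hV hcover ⟨h, hh, hne⟩
        ⟨1, mem_connectedComponentIn (one_mem (normalizer t)),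
          Set.mem_iInter₂.2 fun E hE h => hE.2 h.symm⟩
      rw [Set.mem_iInter₂] at hV'
      refine hV' (g'.1 D) ⟨⟨?_, ?_⟩, hU⟩ rfl
      · rw [← (mem_normalizer _ _).1 (hN g' hg')]
        exact (mem_smul_iff _ _ _).2 ⟨D, hD, rfl⟩
      · rw [← G_pMap, hD']
    have hle : Submodule.span k {D | D ∈ t ∧ pMap D = D} ≤
        LinearMap.eqLocus (h.1 : W k p n →ₗ[k] W k p n) LinearMap.id :=
      Submodule.span_le.2 fun D hD => hfix D hD.1 hD.2
    exact fun D hD => hle (span_toral_smul r g hD)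

end Regular

end JacobsonWitt

end

/-! ### The theorem, by transport from the standard tori. -/

theorem corollary5p4 {k : Type*} [Field k] [IsAlgClosed k] (p : ℕ) [Fact p.Prime] [CharP k p]
    (hp : 3 ≤ p) (n : ℕ) (hpn : n = 1 → 5 ≤ p)
    (t : Submodule k (JacobsonWitt.W k p n)) (ht : JacobsonWitt.IsMaximalTorus t) :
    (∃ r ≤ n, ∃ g : JacobsonWitt.G k p n, g • JacobsonWitt.standardTorus k p n r = t) ∧
    (JacobsonWitt.centralizer t : Set (JacobsonWitt.G k p n)) =
      JacobsonWitt.identityComponent (JacobsonWitt.normalizer t) ∧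
    ∀ r ≤ n, (∃ g : JacobsonWitt.G k p n, g • JacobsonWitt.standardTorus k p n r = t) →
      JacobsonWitt.IsIsomorphicToTorus (JacobsonWitt.centralizer t) (n - r) := by
  refine ⟨ht.exists_conj, ?_, ?_⟩
  · obtain ⟨r, hr, g, rfl⟩ := ht.exists_conj
    exact JacobsonWitt.identityComponent_normalizer hp hpn hr g
  · rintro r hr ⟨g, rfl⟩
    exact JacobsonWitt.isIsomorphicToTorus_centralizer hp hpn hr g
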